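/- **Setting.** Let $m,N\ge 1$, $0<p<2/N$, and let $\alpha_j,\beta_j,\gamma_{ij}=\gamma_{ji},\omega_{ij}=\omega_{ji}\ge 0$ ($i,j=1,\dots,m$). For $u:\mathbb R^N\to\mathbb C^m$ put $|u|_j^{2p}=\alpha_j|u_j|^{2p}+\sum_{i\ne j}\gamma_{ij}|u_i|^{p+1}|u_j|^{p-1}$, $|u|_j^2=\beta_j|u_j|^2+\sum_{i\neq j}\omega_{ij}|u_i|^2$ and $$\mathcal E(u)=\tfrac12\int|\nabla u|^2-\sum_j\tfrac{\alpha_j}{p+1}\int|u_j|^{2p+2}-\sum_{i\ne j}\tfrac{\gamma_{ij}}{p+1}\int|u_i|^{p+1}|u_j|^{p+1}.$$ Let $V,\Phi\in C^3(\mathbb R^N;\mathbb R)$ and $A\in C^3(\mathbb R^N;\mathbb R^N)$ have finite $C^3$ norms, where $\|f\|_{C^k}=\sum_{|a|\le k}\|D^af\|_\infty$, with $V>0$ and $\Phi\ge0$; if $m>1$ suppose moreover that $\Phi\le\Phi(0)$ (for instance $\Phi=0$). For $\varepsilon>0$ let $H_{A,\varepsilon}$ be the closure of $C_c^\infty(\mathbb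 R^N;\mathbb C^m)$, among functions of finite mass $\|u\|_{L^2}^2$, for the norm $\|u\|_{H_{A,\varepsilon}}^2=\int|i^{-1}\nabla u-A(\varepsilon x)u|^2+\int V(\varepsilon x)|u|^2$, and consider $$-i\partial_t\phi_j+\tfrac12\big(i^{-1}\nabla-A(\varepsilon x)\big)^2\phi_j+V(\varepsilon x)\phi_j=|\phi|_j^{2p}\phi_j+\big(\Phi(\varepsilon\,\cdot)*|\phi|_j^2\big)\phi_j,\qquad j=1,\dots,m. \tag{P}$$ Let $r=(r_1,\dots,r_m)\in H^1(\mathbb R^N;\mathbb R^m)$ be a ground state (a nontrivial weak solution with least value of $\mathcal E(u)+\|u\|_{L^2}^2$) of $-\frac12\Delta r_j+r_j=|r|_j^{2p}r_j$, and let $M=\|r\|_{L^2}^2$. Assume that $(V,A,\Phi,r)$ is admissible, that is: * every $r_j$ is radially symmetric and $x_ir_j\in L^2$ for all $i,j$; * (well-posedness) for all $\varepsilon>0$ and $\phi_0\in H_{A,\varepsilon}$, problem (P) with $\phi(0)=\phi_0$ has a unique global solution $\phi\in C([0,\infty),H_{A,\varepsilon})\cap C^1([0,\infty),H_{A,\varepsilon}')$;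 it is bounded in $H_{A,\varepsilon}$, it conserves the masses $\int|\phi_j|^2$ and the energy $\frac12\int|i^{-1}\nabla\phi-A(\varepsilon x)\phi|^2+\int V(\varepsilon x)|\phi|^2-\frac1{p+1}\sum_j\alpha_j\int|\phi_j|^{2p+2}-\frac1{p+1}\sum_{i\ne j}\gamma_{ij}\int|\phi_i|^{p+1}|\phi_j|^{p+1}-\frac12\sum_j\beta_j\iint\Phi(\varepsilon(x-y))|\phi_j(x)|^2|\phi_j(y)|^2-\frac12\sum_{i\neq j}\omega_{ij}\iint\Phi(\varepsilon(x-y))|\phi_i(x)|^2|\phi_j(y)|^2$; and if $\phi_0$ and $(i^{-1}\nabla-A(\varepsilon x))^2\phi_0$ are in $L^2$, then $\phi$ and $(i^{-1}\nabla-A(\varepsilon x))^2\phi$ are in $C([0,\infty),L^2)$ and $\phi\in C^1([0,\infty),L^2)$; * (energy convexity) there are $c,c'>0$ such that $\Gamma_U\le c\,(\mathcal E(U)-\mathcal E(r))$ for every $U\in H^1(\mathbb R^N;\mathbb C^m)$ with $\|U\|_{L^2}=\|r\|_{L^2}$ and $\Gamma_U<c'$, where $\Gamma_U=\inf\big\{\sum_j\|U_j-e^{i\theta_j}r_j(\cdot+y)\|_{H^1}^2: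 y\in\mathbb R^N,\ \theta_1,\dots,\theta_m\in[0,2\pi)\big\}$. Let $x_0,\xi_0\in\mathbb R^N$ and, for $\varepsilon>0$, let $(x_\varepsilon,\xi_\varepsilon)$ be the global solution of $\dot x_\varepsilon=\xi_\varepsilon$, $\dot\xi_\varepsilon=-\varepsilon\nabla V(\varepsilon x_\varepsilon)-\varepsilon\,\xi_\varepsilon\times B(\varepsilon x_\varepsilon)$, $x_\varepsilon(0)=x_0/\varepsilon$, $\xi_\varepsilon(0)=\xi_0$, where $(\xi\times B)_\ell=\sum_i\xi_i(\partial_iA_\ell-\partial_\ell A_i)$. Let $\phi_\varepsilon$ be the solution of (P) with initial datum $\phi_\varepsilon^j(x,0)=r_j(x-x_\varepsilon(0))\,e^{i[A(\varepsilon x_\varepsilon(0))\cdot(x-x_\varepsilon(0))+x\cdot\xi_\varepsilon(0)]}$. Put $$\psi^j_\varepsilon(x,t)=e^{-i\xi_\varepsilon(t)\cdot(x+x_\varepsilon(t))}e^{-iA(\varepsilon x_\varepsilon(t))\cdot x}\phi^j_\varepsilon(x+x_\varepsilon(t),t),\qquad q_\varepsilon=\sum_j\operatorname{Im}\big(\bar\phi^j_\varepsilon(\nabla\phi^j_\varepsilon-iA(\varepsilon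 x)\phi^j_\varepsilon)\big),$$ $$\begin{aligned}\Omega_\varepsilon(t)={}&\Big|\int q_\varepsilon\,dx-M\xi_\varepsilon\Big|+\sup_{\|\varphi\|_{C^3}\le1}\Big|\int\varphi(\varepsilon x)|\phi_\varepsilon|^2dx-M\varphi(\varepsilon x_\varepsilon)\Big|\\&+\Big|M\varepsilon x_\varepsilon-\int\varepsilon x\,\chi(\varepsilon x)|\phi_\varepsilon|^2dx\Big|+\Big|\int A(\varepsilon x)\cdot q_\varepsilon\,dx-MA(\varepsilon x_\varepsilon)\cdot\xi_\varepsilon\Big|,\end{aligned}$$ where $\chi\in C^\infty(\mathbb R^N)$ is a cutoff with $0\le\chi\le1$, $\chi=1$ on $B(0,\tilde\rho)$ and $\chi=0$ outside $B(0,2\tilde\rho)$, for some $\tilde\rho>0$. Fix $T_0>0$ and $0<\sigma_0<c'$ and let $$T^*_\varepsilon=\sup\{t\in[0,T_0/\varepsilon]:\ \Omega_\varepsilon(s)\le\sigma_0\text{ and }\Gamma_{\psi_\varepsilon(s)}\le\sigma_0\text{ for all }s\in(0,t)\}.$$ **Theorem.** There exist $\varepsilon_0>0$, $C>0$ and, for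 $\varepsilon\in(0,\varepsilon_0)$, locally bounded functions $\theta^1_\varepsilon,\dots,\theta^m_\varepsilon:[0,\infty)\to[0,2\pi)$ and $y_\varepsilon:[0,\infty)\to\mathbb R^N$ such that, for all $\varepsilon\in(0,\varepsilon_0)$, $t\in[0,T^*_\varepsilon)$ and $j=1,\dots,m$, $$\phi^j_\varepsilon(x,t)=e^{i(\xi_\varepsilon(t)\cdot x+\theta^j_\varepsilon(t)+A(\varepsilon x_\varepsilon(t))\cdot(x-x_\varepsilon(t)))}\,r_j(x-y_\varepsilon(t))+\omega^j_\varepsilon(x,t),$$ where $\omega^j_\varepsilon(t)\in H^1(\mathbb R^N;\mathbb C)$ and $\|\omega^j_\varepsilon(t)\|_{H^1}\le C\sqrt{\Omega_\varepsilon(t)}+C\varepsilon$. -/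

import Mathlib

noncomputable section

namespace SolitonDynamics

open MeasureTheory Filter Topology Set
open scoped ContDiff ComplexConjugate

/-! ### Sobolev functions through weak gradients -/

/-- Euclidean space `ℝ^N`. -/
abbrev Space (N : ℕ) := EuclideanSpace ℝ (Fin N)

/-- The `k`-th vector of the standard basis of `ℝ^N`. -/
abbrev stdVec {N : ℕ} (k : Fin N) : Space N := EuclideanSpace.single k 1

/-- `C_c^∞` functions on `ℝ^N`. -/
def IsTest {N : ℕ} {F : Type*} [NormedAddCommGroup F] [NormedSpace ℝ F]
    (η : Space N → F) : Prop :=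
  ContDiff ℝ ∞ η ∧ HasCompactSupport η

/-- `g` is the weak (distributional) gradient of `u`. -/
structure HasWeakGrad {N : ℕ} (u : Space N → ℂ) (g : Space N → EuclideanSpace ℂ (Fin N)) :
    Prop where
  locInt : LocallyIntegrable u volume
  locInt_grad : LocallyIntegrable g volume
  integral_eq : ∀ η : Space N → ℝ, IsTest η → ∀ k : Fin N,
    ∫ x, u x * ((fderiv ℝ η x (stdVec k) : ℝ) : ℂ) = -∫ x, g x k * ((η x : ℝ) : ℂ)

open Classical in
/-- The weak gradient of `u`, unique up to null sets (and `0` if there is none). -/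
def weakGrad {N : ℕ} (u : Space N → ℂ) : Space N → EuclideanSpace ℂ (Fin N) :=
  if h : ∃ g, HasWeakGrad u g then h.choose else 0

/-- `u ∈ H^1(ℝ^N; ℂ)`. -/
def MemH1 {N : ℕ} (u : Space N → ℂ) : Prop :=
  MemLp u 2 volume ∧ ∃ g, HasWeakGrad u g ∧ MemLp g 2 volume

/-- `‖u‖_{H^1}^2 = ‖∇u‖_{L^2}^2 + ‖u‖_{L^2}^2`. -/
def h1NormSq {N : ℕ} (u : Space N → ℂ) : ℝ :=
  (∫ x, ‖weakGrad u x‖ ^ 2) + ∫ x, ‖u x‖ ^ 2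

/-- `‖u‖_{H^1}`. -/
def h1Norm {N : ℕ} (u : Space N → ℂ) : ℝ := Real.sqrt (h1NormSq u)

/-- `‖f‖_{C^k} = ∑_{|α| ≤ k} ‖D^α f‖_∞`, with values in `[0, ∞]`. The multi-indices `α` with
`|α| = n` are listed as the nondecreasing `n`-tuples `s` of coordinate indices, and
`D^α f = ∂_{s 0} ⋯ ∂_{s (n-1)} f`. -/
def ckNorm {N : ℕ} {F : Type*} [NormedAddCommGroup F] [NormedSpace ℝ F]
    (k : ℕ) (f : Space N → F) : ENNReal :=
  ∑ n ∈ Finset.range (k + 1), ∑ s : {s : Fin n → Fin N // Monotone s},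
    ⨆ x, ‖iteratedFDeriv ℝ n f x (fun i => stdVec (s.1 i))‖ₑ

/-! ### The Schrödinger system -/

/-- The exponent `p` and the coupling constants `α_j, β_j, γ_{ij}, ω_{ij}` (the last one is
written `w`) of the nonlinearity. -/
structure Couplings (m : ℕ) where
  p : ℝ
  α : Fin m → ℝ
  β : Fin m → ℝ
  γ : Fin m → Fin m → ℝ
  w : Fin m → Fin m → ℝ
  α_nonneg : ∀ j, 0 ≤ α j
  β_nonneg : ∀ j, 0 ≤ β j
  γ_nonneg : ∀ i j, 0 ≤ γ i j
  w_nonneg : ∀ i j, 0 ≤ w i j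
  γ_symm : ∀ i j, γ i j = γ j i
  w_symm : ∀ i j, w i j = w j i

/-- The electric potential `V`, the magnetic potential `A` and the nonlocal potential `Φ`. -/
structure Potentials (N : ℕ) where
  V : Space N → ℝ
  A : Space N → Space N
  Φ : Space N → ℝ

/-- The conditions (V), (A), (Φ) on the potentials. The potential `Φ` may vanish. -/
structure Potentials.Regular {N : ℕ} (P : Potentials N) : Prop where
  V_contDiff : ContDiff ℝ 3 P.V
  V_bdd : ckNorm 3 P.V < ⊤
  V_pos : ∀ x, 0 < P.V x
  A_contDiff : ContDiff ℝ 3 P.A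
  A_bdd : ckNorm 3 P.A < ⊤
  Φ_contDiff : ContDiff ℝ 3 P.Φ
  Φ_bdd : ckNorm 3 P.Φ < ⊤
  Φ_nonneg : ∀ x, 0 ≤ P.Φ x

variable {m N : ℕ}

/-- `|u|_j^{2p} = α_j |u_j|^{2p} + ∑_{i ≠ j} γ_{ij} |u_i|^{p+1} |u_j|^{p-1}`. -/
def locPot (K : Couplings m) (u : Fin m → Space N → ℂ) (j : Fin m) (x : Space N) : ℝ :=
  K.α j * ‖u j x‖ ^ (2 * K.p) +
    ∑ i ∈ Finset.univ.erase j, K.γ i j * ‖u i x‖ ^ (K.p + 1) * ‖u j x‖ ^ (K.p - 1)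

/-- `|u|_j^2 = β_j |u_j|^2 + ∑_{i ≠ j} ω_{ij} |u_i|^2`. -/
def nonlocDensity (K : Couplings m) (u : Fin m → Space N → ℂ) (j : Fin m) (x : Space N) : ℝ :=
  K.β j * ‖u j x‖ ^ 2 + ∑ i ∈ Finset.univ.erase j, K.w i j * ‖u i x‖ ^ 2

/-- The convolution `(Φ(ε ·) * |u|_j^2)(x)`. -/
def nonlocPot (K : Couplings m) (P : Potentials N) (ε : ℝ) (u : Fin m → Space N → ℂ)
    (j : Fin m) (x : Space N) : ℝ :=
  ∫ y, P.Φ (ε • (x - y)) * nonlocDensity K u j y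

/-- The magnetic gradient `Du = i⁻¹ ∇u - A(ε x) u`. -/
def magGrad (A : Space N → Space N) (ε : ℝ) (u : Space N → ℂ) (x : Space N) :
    EuclideanSpace ℂ (Fin N) :=
  WithLp.toLp 2 fun k => -Complex.I * weakGrad u x k - ((A (ε • x) k : ℝ) : ℂ) * u x

/-- `‖u‖_{H_{A,ε}}^2 = ∫ |i⁻¹ ∇u - A(ε x) u|^2 + ∫ V(ε x) |u|^2`. -/
def normSqHA (P : Potentials N) (ε : ℝ) (u : Fin m → Space N → ℂ) : ℝ :=
  ∑ j, ((∫ x, ‖magGrad P.A ε (u j) x‖ ^ 2) + ∫ x, P.V (ε • x) * ‖u j x‖ ^ 2)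

/-- `u ∈ H_{A,ε}`: the closure of `C_c^∞(ℝ^N; ℂ^m)` for the norm `‖·‖_{H_{A,ε}}`, among the
functions of finite mass. -/
def MemHA (P : Potentials N) (ε : ℝ) (u : Fin m → Space N → ℂ) : Prop :=
  (∀ j, MemLp (u j) 2 volume ∧ (∃ g, HasWeakGrad (u j) g) ∧
    MemLp (magGrad P.A ε (u j)) 2 volume ∧ Integrable (fun x => P.V (ε • x) * ‖u j x‖ ^ 2)) ∧
  ∀ η : ℝ, 0 < η → ∃ v : Fin m → Space N → ℂ, (∀ j, IsTest (v j)) ∧ normSqHA P ε (u - v) < η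

/-- The `L^2` pairing `∑_j ∫ u_j \bar v_j`. -/
def pairing (u v : Fin m → Space N → ℂ) : ℂ :=
  ∑ j, ∫ x, u j x * conj (v j x)

/-- The functional `v ↦ ⟨L_A u + V(ε x) u - |u|^{2p} u - (Φ(ε ·) * |u|^2) u, v⟩` in the dual of
`H_{A,ε}`, where `L_A = ½ (i⁻¹ ∇ - A(ε x))^2` acts through its quadratic form. -/
def weakField (K : Couplings m) (P : Potentials N) (ε : ℝ) (u v : Fin m → Space N → ℂ) : ℂ :=
  ∑ j, ∫ x,
    ((1 / 2 : ℂ) * ∑ k, magGrad P.A ε (u j) x k * conj (magGrad P.A ε (v j) x k) +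
      ((P.V (ε • x) - locPot K u j x - nonlocPot K P ε u j x : ℝ) : ℂ)
        * (u j x * conj (v j x)))

/-- `φ ∈ C([0,∞), H_{A,ε}) ∩ C^1([0,∞), H_{A,ε}')` solves the Cauchy problem
`-i ∂_t φ_j + L_A φ_j + V(ε x) φ_j = |φ|_j^{2p} φ_j + (Φ(ε ·) * |φ|_j^2) φ_j`, `φ(0) = φ₀`.
Elements of the dual of `H_{A,ε}` are given by their values on the dense set of test functions;
`hasDeriv` says that `i ∂_t φ(t)` exists in the norm of the dual and equals the functional
`weakField`, and `deriv_cont` that it depends continuously on `t` in that norm. -/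
structure IsSolution (K : Couplings m) (P : Potentials N) (ε : ℝ)
    (φ₀ : Fin m → Space N → ℂ) (φ : ℝ → Fin m → Space N → ℂ) : Prop where
  mem : ∀ t, 0 ≤ t → MemHA P ε (φ t)
  cont : ∀ t, 0 ≤ t → Tendsto (fun s => normSqHA P ε (φ s - φ t)) (𝓝[Ici 0] t) (𝓝 0)
  hasDeriv : ∀ t, 0 ≤ t → ∀ η : ℝ, 0 < η → ∀ᶠ s in 𝓝[Ici 0] t,
    ∀ v : Fin m → Space N → ℂ, (∀ j, IsTest (v j)) →
      ‖Complex.I * pairing (φ s - φ t) v - ((s - t : ℝ) : ℂ) * weakField K P ε (φ t) v‖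
        ≤ η * |s - t| * Real.sqrt (normSqHA P ε v)
  deriv_cont : ∀ t, 0 ≤ t → ∀ η : ℝ, 0 < η → ∀ᶠ s in 𝓝[Ici 0] t,
    ∀ v : Fin m → Space N → ℂ, (∀ j, IsTest (v j)) →
      ‖weakField K P ε (φ s) v - weakField K P ε (φ t) v‖ ≤ η * Real.sqrt (normSqHA P ε v)
  init : ∀ j, φ 0 j =ᵐ[volume] φ₀ j

/-- The `j`-th mass `∫ |u_j|^2`. -/
def mass (u : Fin m → Space N → ℂ) (j : Fin m) : ℝ := ∫ x, ‖u j x‖ ^ 2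

/-- The total energy `E_ε`. -/
def totalEnergy (K : Couplings m) (P : Potentials N) (ε : ℝ) (u : Fin m → Space N → ℂ) : ℝ :=
  (1 / 2) * ∑ j, (∫ x, ‖magGrad P.A ε (u j) x‖ ^ 2)
  + ∑ j, (∫ x, P.V (ε • x) * ‖u j x‖ ^ 2)
  - 1 / (K.p + 1) * ∑ j, K.α j * (∫ x, ‖u j x‖ ^ (2 * K.p + 2))
  - 1 / (K.p + 1) * ∑ j, ∑ i ∈ Finset.univ.erase j,
      K.γ i j * (∫ x, ‖u i x‖ ^ (K.p + 1) * ‖u j x‖ ^ (K.p + 1))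
  - (1 / 2) * ∑ j, K.β j * (∫ x, ∫ y, P.Φ (ε • (x - y)) * ‖u j x‖ ^ 2 * ‖u j y‖ ^ 2)
  - (1 / 2) * ∑ j, ∑ i ∈ Finset.univ.erase j,
      K.w i j * (∫ x, ∫ y, P.Φ (ε • (x - y)) * ‖u i x‖ ^ 2 * ‖u j y‖ ^ 2)

/-- The `k`-th classical magnetic derivative `D_k v = i⁻¹ ∂_k v - A_k(ε x) v`. -/
def magDeriv (A : Space N → Space N) (ε : ℝ) (k : Fin N) (v : Space N → ℂ) (x : Space N) : ℂ :=
  -Complex.I * fderiv ℝ v x (stdVec k) - ((A (ε • x) k : ℝ) : ℂ) * v x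

/-- `f = (i⁻¹ ∇ - A(ε x))^2 u` in the sense of distributions. -/
structure HasMagSq (A : Space N → Space N) (ε : ℝ) (u f : Space N → ℂ) : Prop where
  locInt : LocallyIntegrable u volume
  locInt_sq : LocallyIntegrable f volume
  integral_eq : ∀ v : Space N → ℂ, IsTest v →
    ∫ x, u x * conj (∑ k, magDeriv A ε k (magDeriv A ε k v) x) = ∫ x, f x * conj (v x)

open Classical in
/-- `(i⁻¹ ∇ - A(ε x))^2 u`. -/
def magSq (A : Space N → Space N) (ε : ℝ) (u : Space N → ℂ) : Space N → ℂ :=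
  if h : ∃ f, HasMagSq A ε u f then h.choose else 0

/-- `u ∈ H_{A,ε}^2`. -/
def MemHA2 (P : Potentials N) (ε : ℝ) (u : Fin m → Space N → ℂ) : Prop :=
  ∀ j, MemLp (u j) 2 volume ∧ ∃ f, HasMagSq P.A ε (u j) f ∧ MemLp f 2 volume

/-- `‖u‖_{H_{A,ε}^2}^2`. -/
def normSqHA2 (P : Potentials N) (ε : ℝ) (u : Fin m → Space N → ℂ) : ℝ :=
  ∑ j, ((∫ x, ‖u j x‖ ^ 2) + ∫ x, ‖magSq P.A ε (u j) x‖ ^ 2)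

/-- `φ ∈ C^1([0,∞), L^2(ℝ^N; ℂ^m))`. -/
def IsC1L2 (φ : ℝ → Fin m → Space N → ℂ) : Prop :=
  (∀ t, 0 ≤ t → ∀ j, MemLp (φ t j) 2 volume) ∧
  ∃ φ' : ℝ → Fin m → Space N → ℂ, ∀ t, 0 ≤ t → ∀ j, MemLp (φ' t j) 2 volume ∧
    Tendsto (fun s => ∫ x, ‖((s - t)⁻¹ : ℝ) • (φ s j x - φ t j x) - φ' t j x‖ ^ 2)
      (𝓝[Ici 0 \ {t}] t) (𝓝 0) ∧
    Tendsto (fun s => ∫ x, ‖φ' s j x - φ' t j x‖ ^ 2) (𝓝[Ici 0] t) (𝓝 0)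

/-- Global well-posedness in `H_{A,ε}` for every `ε > 0`, with bounded solutions, conservation of
the masses and of the total energy, and propagation of `H_{A,ε}^2` regularity. -/
def WellPosed (K : Couplings m) (P : Potentials N) : Prop :=
  ∀ ε : ℝ, 0 < ε → ∀ φ₀ : Fin m → Space N → ℂ, MemHA P ε φ₀ →
    (∃ φ, IsSolution K P ε φ₀ φ) ∧
    (∀ φ φ', IsSolution K P ε φ₀ φ → IsSolution K P ε φ₀ φ' →
      ∀ t, 0 ≤ t → ∀ j, φ t j =ᵐ[volume] φ' t j) ∧
    ∀ φ, IsSolution K P ε φ₀ φ →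
      (∃ B : ℝ, ∀ t, 0 ≤ t → normSqHA P ε (φ t) ≤ B) ∧
      (∀ t, 0 ≤ t → ∀ j, mass (φ t) j = mass (φ 0) j) ∧
      (∀ t, 0 ≤ t → totalEnergy K P ε (φ t) = totalEnergy K P ε (φ 0)) ∧
      (MemHA2 P ε φ₀ →
        (∀ t, 0 ≤ t → MemHA2 P ε (φ t)) ∧
        (∀ t, 0 ≤ t → Tendsto (fun s => normSqHA2 P ε (φ s - φ t)) (𝓝[Ici 0] t) (𝓝 0)) ∧
        IsC1L2 φ)

/-! ### Ground states -/

/-- A real-valued vector function, seen as a complex-valued one. -/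
def cplx (r : Fin m → Space N → ℝ) : Fin m → Space N → ℂ := fun j x => (r j x : ℂ)

/-- The functional `𝓔`. -/
def energy (K : Couplings m) (u : Fin m → Space N → ℂ) : ℝ :=
  (1 / 2) * ∑ j, (∫ x, ‖weakGrad (u j) x‖ ^ 2)
  - ∑ j, K.α j / (K.p + 1) * (∫ x, ‖u j x‖ ^ (2 * K.p + 2))
  - ∑ j, ∑ i ∈ Finset.univ.erase j,
      K.γ i j / (K.p + 1) * (∫ x, ‖u i x‖ ^ (K.p + 1) * ‖u j x‖ ^ (K.p + 1))

/-- The total mass `M = ∑_j ‖u_j‖_{L^2}^2`. -/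
def totalMass (u : Fin m → Space N → ℂ) : ℝ := ∑ j, mass u j

/-- `u ∈ H^1(ℝ^N; ℝ^m)` is a nontrivial weak solution of `-½ Δu_j + u_j = |u|_j^{2p} u_j`. -/
structure IsStationary (K : Couplings m) (u : Fin m → Space N → ℝ) : Prop where
  memH1 : ∀ j, MemH1 (cplx u j)
  ne_zero : ∃ j, ¬ u j =ᵐ[volume] 0
  weak_eq : ∀ j, ∀ η : Space N → ℝ, IsTest η →
    (1 / 2 : ℂ) * ∑ k, (∫ x, weakGrad (cplx u j) x k * ((fderiv ℝ η x (stdVec k) : ℝ) : ℂ))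
      + ∫ x, ((u j x * η x : ℝ) : ℂ)
    = ∫ x, ((locPot K (cplx u) j x * u j x * η x : ℝ) : ℂ)

/-- A real ground state: a nontrivial solution of least action, the action of `u` being
`½ (𝓔(u) + ‖u‖_{L^2}^2)`. -/
structure IsGroundState (K : Couplings m) (r : Fin m → Space N → ℝ) : Prop where
  stationary : IsStationary K r
  least : ∀ u : Fin m → Space N → ℝ, IsStationary K u →
    energy K (cplx r) + totalMass (cplx r) ≤ energy K (cplx u) + totalMass (cplx u)

/-- `Γ_U`: the infimum over `y ∈ ℝ^N` and `θ_1, …, θ_m ∈ [0, 2π)` of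
`‖U - (e^{iθ_1} r_1(· + y), …, e^{iθ_m} r_m(· + y))‖_{H^1}^2`. -/
def orbitDistSq (r : Fin m → Space N → ℝ) (U : Fin m → Space N → ℂ) : ℝ :=
  sInf {d : ℝ | ∃ (y : Space N) (θ : Fin m → ℝ), (∀ j, θ j ∈ Ico 0 (2 * Real.pi)) ∧
    d = ∑ j, h1NormSq fun x => U j x - Complex.exp (Complex.I * (θ j : ℂ)) * (r j (x + y) : ℂ)}

/-- The energy convexity inequality, with constants `c` and `c'`. -/
def EnergyConvexity (K : Couplings m) (r : Fin m → Space N → ℝ) (c c' : ℝ) : Prop :=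
  ∀ U : Fin m → Space N → ℂ, (∀ j, MemH1 (U j)) → totalMass U = totalMass (cplx r) →
    orbitDistSq r U < c' → orbitDistSq r U ≤ c * (energy K U - energy K (cplx r))

/-- `(V, A, Φ, r)` is an admissible string, with constants `c, c'` in the energy convexity
inequality. -/
structure Admissible (K : Couplings m) (P : Potentials N) (r : Fin m → Space N → ℝ)
    (c c' : ℝ) : Prop where
  radial : ∀ j x y, ‖x‖ = ‖y‖ → r j x = r j y
  moment : ∀ j, ∀ i : Fin N, MemLp (fun x : Space N => x i * r j x) 2 volume
  wellPosed : WellPosed K P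
  c_pos : 0 < c
  c'_pos : 0 < c'
  convexity : EnergyConvexity K r c c'

/-! ### The trajectory, the initial datum, and the quantities `ψ_ε`, `Ω_ε`, `T_ε^*` -/

/-- `v × B(z)`, for the magnetic field `B = ∇ × A` seen as the 2-form with coefficients
`B_{iℓ} = ∂_i A_ℓ - ∂_ℓ A_i`: `(v × B)_ℓ = ∑_i v_i B_{iℓ}`. -/
def crossB (A : Space N → Space N) (v z : Space N) : Space N :=
  WithLp.toLp 2 fun l => ∑ i, v i * (fderiv ℝ A z (stdVec i) l - fderiv ℝ A z (stdVec l) i)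

/-- `(x, ξ)` is the global solution of `ẋ = ξ`, `ξ̇ = -ε ∇V(ε x) - ε ξ × B(ε x)`,
`x(0) = x₀ / ε`, `ξ(0) = ξ₀`. -/
structure IsTrajectory (P : Potentials N) (ε : ℝ) (x₀ ξ₀ : Space N) (x ξ : ℝ → Space N) :
    Prop where
  x_init : x 0 = ε⁻¹ • x₀
  ξ_init : ξ 0 = ξ₀
  x_deriv : ∀ t, 0 ≤ t → HasDerivWithinAt x (ξ t) (Ici 0) t
  ξ_deriv : ∀ t, 0 ≤ t → HasDerivWithinAt ξ
    (-(ε • gradient P.V (ε • x t)) - ε • crossB P.A (ξ t) (ε • x t)) (Ici 0) t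

/-- The initial datum `r_j(x - X) e^{i [A(ε X) · (x - X) + x · Ξ]}`. -/
def initialDatum (A : Space N → Space N) (ε : ℝ) (r : Fin m → Space N → ℝ) (X Ξ : Space N) :
    Fin m → Space N → ℂ :=
  fun j x => (r j (x - X) : ℂ) *
    Complex.exp (Complex.I * ((inner ℝ (A (ε • X)) (x - X) + inner ℝ x Ξ : ℝ) : ℂ))

/-- `ψ_j(x) = e^{-i Ξ · (x + X)} e^{-i A(ε X) · x} u_j(x + X)`. -/
def recentred (A : Space N → Space N) (ε : ℝ) (u : Fin m → Space N → ℂ) (X Ξ : Space N) :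
    Fin m → Space N → ℂ :=
  fun j x => Complex.exp (-Complex.I * ((inner ℝ Ξ (x + X) : ℝ) : ℂ)) *
    Complex.exp (-Complex.I * ((inner ℝ (A (ε • X)) x : ℝ) : ℂ)) * u j (x + X)

/-- The total magnetic momentum `q^A = ∑_j Im(\bar u_j (∇u_j - i A(ε x) u_j))`. -/
def momentum (A : Space N → Space N) (ε : ℝ) (u : Fin m → Space N → ℂ) (x : Space N) : Space N :=
  WithLp.toLp 2 fun k => ∑ j,
    (conj (u j x) * (weakGrad (u j) x k - Complex.I * ((A (ε • x) k : ℝ) : ℂ) * u j x)).im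

/-- The density `|u|^2 = ∑_j |u_j|^2`. -/
def density (u : Fin m → Space N → ℂ) (x : Space N) : ℝ := ∑ j, ‖u j x‖ ^ 2

/-- A smooth cutoff: `0 ≤ χ ≤ 1`, `χ = 1` in `B(0, ρ)`, `χ = 0` outside `B(0, 2ρ)`. -/
structure IsCutoff (ρ : ℝ) (χ : Space N → ℝ) : Prop where
  smooth : ContDiff ℝ ∞ χ
  nonneg : ∀ x, 0 ≤ χ x
  le_one : ∀ x, χ x ≤ 1
  eq_one : ∀ x ∈ Metric.ball (0 : Space N) ρ, χ x = 1
  eq_zero : ∀ x ∉ Metric.ball (0 : Space N) (2 * ρ), χ x = 0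

/-- The functional `φ ↦ ∫ Π² φ = ∫ φ(ε x) |u|^2 - M φ(ε X)`. -/
def densityDefect (ε M : ℝ) (u : Fin m → Space N → ℂ) (X : Space N) (φ : Space N → ℝ) : ℝ :=
  (∫ x, φ (ε • x) * density u x) - M * φ (ε • X)

/-- `|∫ Π¹| + sup_{‖φ‖_{C³} ≤ 1} |∫ Π² φ| + |γ|`, with
`∫ Π¹ = ∫ q^A - M Ξ` and `γ = M ε X - ∫ ε x χ(ε x) |u|^2`. -/
def omegaHat (A : Space N → Space N) (χ : Space N → ℝ) (ε M : ℝ) (u : Fin m → Space N → ℂ)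
    (X Ξ : Space N) : ℝ :=
  ‖(∫ x, momentum A ε u x) - M • Ξ‖
  + sSup {d : ℝ | ∃ φ : Space N → ℝ, ContDiff ℝ 3 φ ∧ ckNorm 3 φ ≤ 1 ∧
      d = |densityDefect ε M u X φ|}
  + ‖M • (ε • X) - ∫ x, (χ (ε • x) * density u x) • (ε • x)‖

/-- `ρ^A = |∫ Π¹ · A| = |∫ A(ε x) · q^A - M A(ε X) · Ξ|`. -/
def rhoA (A : Space N → Space N) (ε M : ℝ) (u : Fin m → Space N → ℂ) (X Ξ : Space N) : ℝ :=
  |(∫ x, inner ℝ (A (ε • x)) (momentum A ε u x)) - M * inner ℝ (A (ε • X)) Ξ|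

/-- `Ω = Ω̂ + ρ^A`. -/
def omega (A : Space N → Space N) (χ : Space N → ℝ) (ε M : ℝ) (u : Fin m → Space N → ℂ)
    (X Ξ : Space N) : ℝ :=
  omegaHat A χ ε M u X Ξ + rhoA A ε M u X Ξ

/-- `sup {t ∈ [0, T] : Ω(s), Γ(s) ≤ σ for all s ∈ (0, t)}`. -/
def exitTime (T σ : ℝ) (Ω Γ : ℝ → ℝ) : ℝ :=
  sSup {t : ℝ | t ∈ Icc 0 T ∧ ∀ s ∈ Ioo 0 t, Ω s ≤ σ ∧ Γ s ≤ σ}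

/-- `f : [0, ∞) → F` is locally bounded. -/
def LocBdd {F : Type*} [Norm F] (f : ℝ → F) : Prop :=
  ∀ T : ℝ, ∃ B : ℝ, ∀ t ∈ Icc 0 T, ‖f t‖ ≤ B

end SolitonDynamics

end

/-!
Write `b = ξ_ε + A(ε x_ε)` and let `q` be the magnetic momentum density of `φ_ε`. Recentring
completes a square: the energy of `ψ_ε` is

`𝓔(ψ_ε) = E_ε(φ_ε) - ∫ V(ε x)|φ_ε|² + F + ½ ∫ |b - A(ε x)|² |φ_ε|² - ∫ ⟨b - A(ε x), q⟩`,

where `F` is the nonlocal interaction energy. At time `t` each of these terms is replaced by its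
value for a mass `M` moving with the particle `(x_ε(t), ξ_ε(t))`, and `Ω_ε` bounds the resulting
error. At time `0` the density is that of the radial ground state, so the first-order Taylor terms
integrate to zero and the errors are `O(ε²)`. Conservation of mass, of `E_ε` and of the classical
Hamiltonian `½|ξ|² + V(ε x)` cancels everything else, whence `𝓔(ψ_ε) - 𝓔(r) ≤ C (Ω_ε + ε²)`, and
energy convexity turns this into `Γ ≤ C (Ω_ε + ε²)`. Only an upper bound for `F(t) - F(0)` is
needed; for `m > 1` it comes from `Φ ≤ Φ(0)`, while for `m = 1` the single density is controlled by
the density part of `Ω_ε`, used once in each variable of the double integral.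

Almost minimising translations could a priori be unbounded in time. They are not: if `Ω_ε + ε²` is
small, `ψ_ε` carries mass near the point where the density part of `Ω_ε` locates it, which confines
the translation to a ball of radius `1/ε + O(1)`; if `Ω_ε` is not small, the zero translation will
do. Undoing the recentring is multiplication by a plane wave of frequency `b`, which is bounded by
conservation of the Hamiltonian, and so costs only a constant in `H¹`.
-/

noncomputable section

namespace SolitonDynamics

open MeasureTheory Filter Topology Set
open scoped ContDiff ComplexConjugate

variable {m N : ℕ}

/-! ### Calculus of weak gradients -/

lemma IsTest.fderiv_apply {η : Space N → ℝ} (hη : IsTest η) (v : Space N) :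
    IsTest fun x => fderiv ℝ η x v :=
  ⟨(hη.1.fderiv_right (m := ∞) (by simp)).clm_apply contDiff_const, hη.2.fderiv_apply (𝕜 := ℝ) v⟩

lemma IsTest.comp_add {η : Space N → ℝ} (hη : IsTest η) (a : Space N) :
    IsTest fun x => η (x + a) :=
  ⟨hη.1.comp (contDiff_id.add contDiff_const), hη.2.comp_homeomorph (Homeomorph.addRight a)⟩

lemma IsTest.mul_left {η f : Space N → ℝ} (hη : IsTest η) (hf : ContDiff ℝ ∞ f) :
    IsTest fun x => f x * η x :=
  ⟨hf.mul hη.1, hη.2.mul_left⟩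

lemma IsTest.integrable_mul {u : Space N → ℂ} (hu : LocallyIntegrable u volume)
    {η : Space N → ℝ} (hη : IsTest η) : Integrable fun x => u x * ((η x : ℝ) : ℂ) := by
  refine (hu.integrable_smul_left_of_hasCompactSupport hη.1.continuous hη.2).congr
    (Eventually.of_forall fun x => ?_)
  simp [mul_comm]

lemma locallyIntegrable_coord {g : Space N → EuclideanSpace ℂ (Fin N)}
    (hg : LocallyIntegrable g volume) (k : Fin N) :
    LocallyIntegrable (fun x => g x k) volume :=
  hg.mono ((EuclideanSpace.proj (𝕜 := ℂ) k).continuous.comp_aestronglyMeasurable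
    hg.aestronglyMeasurable) (Eventually.of_forall fun x => PiLp.norm_apply_le (g x) k)

lemma locallyIntegrable_comp_add {F : Type*} [NormedAddCommGroup F] {f : Space N → F}
    (hf : LocallyIntegrable f volume) (a : Space N) :
    LocallyIntegrable (fun x => f (x + a)) volume := by
  have hmap : Measure.map (Homeomorph.addRight a) (volume : Measure (Space N)) = volume :=
    map_add_right_eq_self volume a
  exact (locallyIntegrable_map_homeomorph (Homeomorph.addRight a)).1 (hmap.symm ▸ hf)

namespace HasWeakGrad

variable {u v : Space N → ℂ} {g h : Space N → EuclideanSpace ℂ (Fin N)}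

lemma ae_unique (hg : HasWeakGrad u g) (hh : HasWeakGrad u h) : g =ᵐ[volume] h := by
  have hcoord : ∀ k, ∀ᵐ x, g x k = h x k := fun k => by
    refine ae_eq_of_integral_contDiff_smul_eq (locallyIntegrable_coord hg.locInt_grad k)
      (locallyIntegrable_coord hh.locInt_grad k) fun η hη hη' => ?_
    simpa [mul_comm] using
      (hg.integral_eq η ⟨hη, hη'⟩ k).symm.trans (hh.integral_eq η ⟨hη, hη'⟩ k)
  filter_upwards [ae_all_iff.2 hcoord] with x hx
  ext k
  exact hx k

protected lemma weakGrad (hg : HasWeakGrad u g) : HasWeakGrad u (weakGrad u) := by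
  have hex : ∃ g, HasWeakGrad u g := ⟨g, hg⟩
  rw [SolitonDynamics.weakGrad, dif_pos hex]
  exact hex.choose_spec

lemma weakGrad_ae_eq (hg : HasWeakGrad u g) : SolitonDynamics.weakGrad u =ᵐ[volume] g :=
  hg.weakGrad.ae_unique hg

lemma congr (hg : HasWeakGrad u g) (huv : u =ᵐ[volume] v) : HasWeakGrad v g where
  locInt := hg.locInt.mono (hg.locInt.aestronglyMeasurable.congr huv)
    (by filter_upwards [huv] with x hx using by rw [hx])
  locInt_grad := hg.locInt_grad
  integral_eq η hη k := by
    rw [← hg.integral_eq η hη k]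
    refine integral_congr_ae ?_
    filter_upwards [huv] with x hx using by rw [hx]

lemma add (hg : HasWeakGrad u g) (hh : HasWeakGrad v h) :
    HasWeakGrad (fun x => u x + v x) (fun x => g x + h x) where
  locInt := hg.locInt.add hh.locInt
  locInt_grad := hg.locInt_grad.add hh.locInt_grad
  integral_eq η hη k := by
    have hη' := hη.fderiv_apply (stdVec k)
    simp only [add_mul, PiLp.add_apply]
    rw [integral_add (hη'.integrable_mul hg.locInt) (hη'.integrable_mul hh.locInt),
      integral_add (hη.integrable_mul (locallyIntegrable_coord hg.locInt_grad k))
        (hη.integrable_mul (locallyIntegrable_coord hh.locInt_grad k)),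
      hg.integral_eq η hη k, hh.integral_eq η hη k, neg_add]

lemma const_mul (hg : HasWeakGrad u g) (c : ℂ) :
    HasWeakGrad (fun x => c * u x) (fun x => c • g x) where
  locInt := hg.locInt.smul c
  locInt_grad := hg.locInt_grad.smul c
  integral_eq η hη k := by
    simp only [PiLp.smul_apply, smul_eq_mul, mul_assoc]
    rw [integral_const_mul, integral_const_mul, hg.integral_eq η hη k, mul_neg]

lemma sub (hg : HasWeakGrad u g) (hh : HasWeakGrad v h) :
    HasWeakGrad (fun x => u x - v x) (fun x => g x - h x) := by
  simpa [sub_eq_add_neg] using hg.add (hh.const_mul (-1))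

lemma comp_add (hg : HasWeakGrad u g) (a : Space N) :
    HasWeakGrad (fun x => u (x + a)) (fun x => g (x + a)) where
  locInt := locallyIntegrable_comp_add hg.locInt a
  locInt_grad := locallyIntegrable_comp_add hg.locInt_grad a
  integral_eq η hη k := by
    have e := hg.integral_eq _ (hη.comp_add (-a)) k
    rw [← integral_add_right_eq_self _ a, ← integral_add_right_eq_self (fun x => g x k * _) a] at e
    simpa [fderiv_comp_add_right] using e

end HasWeakGrad

lemma HasWeakGrad.conj {u : Space N → ℂ} {g : Space N → EuclideanSpace ℂ (Fin N)}
    (hg : HasWeakGrad u g) :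
    HasWeakGrad (fun x => conj (u x)) (fun x => WithLp.toLp 2 fun k => conj (g x k)) where
  locInt := hg.locInt.mono
    (Complex.continuous_conj.comp_aestronglyMeasurable hg.locInt.aestronglyMeasurable)
    (Eventually.of_forall fun x => by simp)
  locInt_grad := by
    have hcont : Continuous fun v : EuclideanSpace ℂ (Fin N) =>
        (WithLp.toLp 2 fun k => conj (v k) : EuclideanSpace ℂ (Fin N)) := by fun_prop
    exact hg.locInt_grad.mono
      (hcont.comp_aestronglyMeasurable hg.locInt_grad.aestronglyMeasurable)
      (Eventually.of_forall fun x => by simp [EuclideanSpace.norm_eq])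
  integral_eq η hη k := by
    have e := congrArg (starRingEnd ℂ) (hg.integral_eq η hη k)
    rw [map_neg, ← integral_conj, ← integral_conj] at e
    simpa using e

lemma HasWeakGrad.im_eq_zero {r : Space N → ℝ} {g : Space N → EuclideanSpace ℂ (Fin N)}
    (hg : HasWeakGrad (fun x => (r x : ℂ)) g) :
    ∀ᵐ x, ∀ k, (g x k).im = 0 := by
  have hconj := hg.conj
  simp only [Complex.conj_ofReal] at hconj
  filter_upwards [hg.ae_unique hconj] with x hx k
  exact Complex.conj_eq_iff_im.1 (congrArg (fun v : EuclideanSpace ℂ (Fin N) => v k) hx).symm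

/-- The classical gradient of a real function, as a complex vector field. -/
def complexGrad (f : Space N → ℝ) (x : Space N) : EuclideanSpace ℂ (Fin N) :=
  WithLp.toLp 2 fun k => ((fderiv ℝ f x (stdVec k) : ℝ) : ℂ)

lemma continuous_complexGrad {f : Space N → ℝ} (hf : ContDiff ℝ ∞ f) :
    Continuous (complexGrad f) := by
  have := hf.continuous_fderiv (by simp)
  unfold complexGrad
  fun_prop

lemma HasWeakGrad.smooth_mul {u : Space N → ℂ} {g : Space N → EuclideanSpace ℂ (Fin N)}
    (hg : HasWeakGrad u g) {f : Space N → ℝ} (hf : ContDiff ℝ ∞ f) :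
    HasWeakGrad (fun x => (f x : ℂ) * u x)
      (fun x => (f x : ℂ) • g x + u x • complexGrad f x) where
  locInt := hg.locInt.continuous_smul (Complex.continuous_ofReal.comp hf.continuous)
  locInt_grad := (hg.locInt_grad.continuous_smul (Complex.continuous_ofReal.comp hf.continuous)).add
    (hg.locInt.smul_continuous (continuous_complexGrad hf))
  integral_eq η hη k := by
    have hfη := hη.mul_left hf
    have hf'η := hη.mul_left ((hf.fderiv_right (m := ∞) (by simp)).clm_apply
      (contDiff_const (c := stdVec k)))
    have leibniz : ∀ x, fderiv ℝ (fun x => f x * η x) x (stdVec k)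
        = f x * fderiv ℝ η x (stdVec k) + fderiv ℝ f x (stdVec k) * η x := fun x => by
      rw [fderiv_fun_mul (hf.differentiable (by simp) x) (hη.1.differentiable (by simp) x)]
      simp [mul_comm]
    calc ∫ x, (f x : ℂ) * u x * ((fderiv ℝ η x (stdVec k) : ℝ) : ℂ)
        = ∫ x, (u x * ((fderiv ℝ (fun x => f x * η x) x (stdVec k) : ℝ) : ℂ)
            - u x * ((fderiv ℝ f x (stdVec k) * η x : ℝ) : ℂ)) := by
          refine integral_congr_ae (Eventually.of_forall fun x => ?_)
          simp only [leibniz]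
          push_cast
          ring
      _ = -(∫ x, g x k * ((f x * η x : ℝ) : ℂ))
            - ∫ x, u x * ((fderiv ℝ f x (stdVec k) * η x : ℝ) : ℂ) := by
          rw [integral_sub ((hfη.fderiv_apply (stdVec k)).integrable_mul hg.locInt)
            (hf'η.integrable_mul hg.locInt), hg.integral_eq _ hfη k]
      _ = -∫ x, (g x k * ((f x * η x : ℝ) : ℂ)
            + u x * ((fderiv ℝ f x (stdVec k) * η x : ℝ) : ℂ)) := by
          rw [integral_add (hfη.integrable_mul (locallyIntegrable_coord hg.locInt_grad k))
            (hf'η.integrable_mul hg.locInt), neg_add, sub_eq_add_neg]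
      _ = _ := by
          congr 1
          refine integral_congr_ae (Eventually.of_forall fun x => ?_)
          simp only [complexGrad, PiLp.add_apply, PiLp.smul_apply, smul_eq_mul]
          push_cast
          ring

/-- The plane wave `e^{i (b · x + κ)}`. -/
def planeWave (b : Space N) (κ : ℝ) (x : Space N) : ℂ :=
  Complex.exp (Complex.I * ((inner ℝ b x + κ : ℝ) : ℂ))

lemma planeWave_eq_cos_add_sin (b : Space N) (κ : ℝ) (x : Space N) :
    planeWave b κ x = ((Real.cos (inner ℝ b x + κ) : ℝ) : ℂ)
      + Complex.I * ((Real.sin (inner ℝ b x + κ) : ℝ) : ℂ) := by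
  rw [planeWave, mul_comm, Complex.exp_mul_I, mul_comm Complex.I]
  simp

@[simp] lemma norm_planeWave (b : Space N) (κ : ℝ) (x : Space N) : ‖planeWave b κ x‖ = 1 := by
  rw [planeWave, mul_comm, Complex.norm_exp_ofReal_mul_I]

lemma continuous_planeWave (b : Space N) (κ : ℝ) : Continuous (planeWave b κ) := by
  unfold planeWave; fun_prop

/-- The complex vector `i b`: the logarithmic gradient of `planeWave b κ`. -/
def imVec (b : Space N) : EuclideanSpace ℂ (Fin N) :=
  WithLp.toLp 2 fun k => Complex.I * ((b k : ℝ) : ℂ)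

@[simp] lemma imVec_apply (b : Space N) (k : Fin N) :
    imVec b k = Complex.I * ((b k : ℝ) : ℂ) := rfl

@[simp] lemma norm_imVec (b : Space N) : ‖imVec b‖ = ‖b‖ := by
  simp [EuclideanSpace.norm_eq]

lemma HasWeakGrad.planeWave_mul {u : Space N → ℂ} {g : Space N → EuclideanSpace ℂ (Fin N)}
    (hg : HasWeakGrad u g) (b : Space N) (κ : ℝ) :
    HasWeakGrad (fun x => planeWave b κ x * u x)
      (fun x => planeWave b κ x • (g x + u x • imVec b)) := by
  set L : Space N → ℝ := fun x => inner ℝ b x + κ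
  have hL : ContDiff ℝ ∞ L := (contDiff_const.inner ℝ contDiff_id).add contDiff_const
  have hL' : ∀ x, HasFDerivAt L (innerSL ℝ b) x := fun x => (innerSL ℝ b).hasFDerivAt.add_const κ
  have hcos : ∀ x k, fderiv ℝ (fun y => Real.cos (L y)) x (stdVec k) = -(Real.sin (L x) * b k) :=
    fun x k => by
      rw [(hL' x).cos.fderiv]
      simp [EuclideanSpace.inner_single_right]
  have hsin : ∀ x k, fderiv ℝ (fun y => Real.sin (L y)) x (stdVec k) = Real.cos (L x) * b k :=
    fun x k => by
      rw [(hL' x).sin.fderiv]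
      simp [EuclideanSpace.inner_single_right]
  have hsplit : ∀ x, planeWave b κ x = (Real.cos (L x) : ℂ) + Complex.I * (Real.sin (L x) : ℂ) :=
    planeWave_eq_cos_add_sin b κ
  convert (hg.smooth_mul hL.cos).add ((hg.smooth_mul hL.sin).const_mul Complex.I) using 2 with x x
  · rw [hsplit]
    ring
  · ext k
    simp only [hsplit, complexGrad, hcos, hsin, PiLp.smul_apply, PiLp.add_apply, imVec_apply,
      smul_eq_mul]
    push_cast
    linear_combination (u x * Complex.sin (L x) * b k) * Complex.I_sq

/-! ### Symmetry of iterated derivatives -/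

section IteratedDerivatives

variable {E F : Type*} [NormedAddCommGroup E] [NormedSpace ℝ E] [NormedAddCommGroup F]
  [NormedSpace ℝ F]

lemma fderiv_iteratedFDeriv_apply {f : E → F} {n : ℕ} (hf : ContDiff ℝ (n + 1 : ℕ) f) (x a : E)
    (v : Fin n → E) :
    fderiv ℝ (fun y => iteratedFDeriv ℝ n f y v) x a
      = iteratedFDeriv ℝ (n + 1) f x (Fin.cons a v) := by
  have hd : DifferentiableAt ℝ (iteratedFDeriv ℝ n f) x :=
    hf.differentiable_iteratedFDeriv (by exact_mod_cast n.lt_succ_self) x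
  have happly := (ContinuousMultilinearMap.apply ℝ (fun _ : Fin n => E) F v).hasFDerivAt.comp x
    hd.hasFDerivAt
  rw [iteratedFDeriv_succ_apply_left]
  exact congrArg (fun T : E →L[ℝ] F => T a) happly.fderiv

lemma iteratedFDeriv_cons_cons_comm {f : E → F} {n : ℕ} (hf : ContDiff ℝ (n + 2 : ℕ) f)
    (x a b : E) (v : Fin n → E) :
    iteratedFDeriv ℝ (n + 2) f x (Fin.cons a (Fin.cons b v))
      = iteratedFDeriv ℝ (n + 2) f x (Fin.cons b (Fin.cons a v)) := by
  set g : E → F := fun y => iteratedFDeriv ℝ n f y v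
  have hg : ContDiff ℝ 2 g :=
    (ContinuousMultilinearMap.apply ℝ (fun _ : Fin n => E) F v).contDiff.comp
      (hf.iteratedFDeriv_right (by exact_mod_cast (Nat.add_comm 2 n).le))
  have hg' : Differentiable ℝ (fderiv ℝ g) :=
    (hg.fderiv_right (m := 1) (by norm_num)).differentiable (by norm_num)
  have hsecond : ∀ a b, iteratedFDeriv ℝ (n + 2) f x (Fin.cons a (Fin.cons b v))
      = fderiv ℝ (fderiv ℝ g) x a b := fun a b => by
    rw [← fderiv_iteratedFDeriv_apply hf]
    simp_rw [← fderiv_iteratedFDeriv_apply (hf.of_le (by exact_mod_cast (n + 1).le_succ))]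
    rw [fderiv_clm_apply hg'.differentiableAt (differentiableAt_const b)]
    simp [g]
  rw [hsecond, hsecond]
  exact hg.contDiffAt.isSymmSndFDerivAt (by simp) a b

lemma iteratedFDeriv_comp_swap_castSucc_succ {f : E → F} {n : ℕ}
    (hf : ContDiff ℝ (n + 1 : ℕ) f) (i : Fin n) (x : E) (v : Fin (n + 1) → E) :
    iteratedFDeriv ℝ (n + 1) f x (v ∘ Equiv.swap i.castSucc i.succ)
      = iteratedFDeriv ℝ (n + 1) f x v := by
  induction n generalizing x with
  | zero => exact i.elim0
  | succ n ih =>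
    refine Fin.cases ?_ (fun i => ?_) i
    · have hv : v = Fin.cons (v 0) (Fin.cons (v 1) fun k => v k.succ.succ) := by
        ext k
        exact Fin.cases rfl (Fin.cases rfl fun _ => rfl) k
      have hswap : v ∘ Equiv.swap (Fin.castSucc 0) (Fin.succ 0)
          = Fin.cons (v 1) (Fin.cons (v 0) fun k => v k.succ.succ) := by
        ext k
        refine Fin.cases (by simp) (Fin.cases (by simp) fun k => ?_) k
        simp [Equiv.swap_apply_of_ne_of_ne, Fin.ext_iff]
      rw [hswap, iteratedFDeriv_cons_cons_comm hf, ← hv]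
    · have hswap : v ∘ Equiv.swap i.succ.castSucc i.succ.succ
          = Fin.cons (v 0) (Fin.tail v ∘ Equiv.swap i.castSucc i.succ) := by
        ext k
        refine Fin.cases ?_ (fun k => ?_) k
        · simp [Equiv.swap_apply_of_ne_of_ne, Fin.ext_iff]
        · simp [Fin.tail, ← (Fin.succ_injective _).map_swap]
      have hf' : ContDiff ℝ (n + 1 : ℕ) f := hf.of_le (by exact_mod_cast (n + 1).le_succ)
      rw [hswap, ← fderiv_iteratedFDeriv_apply hf]
      simp_rw [ih hf' i]
      rw [fderiv_iteratedFDeriv_apply hf, Fin.cons_self_tail]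

lemma iteratedFDeriv_comp_perm {f : E → F} {n : ℕ} (hf : ContDiff ℝ n f) (x : E)
    (σ : Equiv.Perm (Fin n)) (v : Fin n → E) :
    iteratedFDeriv ℝ n f x (v ∘ σ) = iteratedFDeriv ℝ n f x v := by
  cases n with
  | zero => rw [Subsingleton.elim (v ∘ σ) v]
  | succ n =>
    have hσ : σ ∈ Submonoid.closure (range fun i : Fin n => Equiv.swap i.castSucc i.succ) :=
      Equiv.Perm.mclosure_swap_castSucc_succ n ▸ Submonoid.mem_top σ
    induction hσ using Submonoid.closure_induction generalizing v with
    | mem σ hσ =>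
      obtain ⟨i, rfl⟩ := hσ
      exact iteratedFDeriv_comp_swap_castSucc_succ hf i x v
    | one => rfl
    | mul σ τ _ _ hσ hτ =>
      rw [← hσ v, ← hτ (v ∘ σ)]
      rfl

end IteratedDerivatives

/-! ### Functions with bounded derivatives -/

section DerivBound

variable {E F : Type*} [NormedAddCommGroup E] [NormedSpace ℝ E] [NormedAddCommGroup F]
  [NormedSpace ℝ F]

/-- `f` is of class `C^k` and its derivatives of order at most `k` are bounded by `B` in operator
norm. On `ℝ^N` this amounts to finiteness of `ckNorm k f`, up to constants. -/
structure DerivBound (k : ℕ) (f : E → F) (B : ℝ) : Prop where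
  contDiff : ContDiff ℝ k f
  norm_iteratedFDeriv_le : ∀ n ≤ k, ∀ x, ‖iteratedFDeriv ℝ n f x‖ ≤ B

namespace DerivBound

variable {k : ℕ} {f : E → F} {B : ℝ}

lemma norm_le (hf : DerivBound k f B) (x : E) : ‖f x‖ ≤ B := by
  simpa using hf.norm_iteratedFDeriv_le 0 k.zero_le x

lemma nonneg (hf : DerivBound k f B) : 0 ≤ B :=
  (norm_nonneg _).trans (hf.norm_le 0)

lemma continuous (hf : DerivBound k f B) : Continuous f :=
  hf.contDiff.continuous

lemma comp_sub_const (hf : DerivBound k f B) (w : E) : DerivBound k (fun z => f (z - w)) B := by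
  refine ⟨hf.contDiff.comp (contDiff_id.sub contDiff_const), fun n hn x => ?_⟩
  rw [iteratedFDeriv_comp_sub]
  exact hf.norm_iteratedFDeriv_le n hn _

lemma const_smul (hf : DerivBound k f B) (a : ℝ) : DerivBound k (fun z => a • f z) (|a| * B) := by
  refine ⟨contDiff_const.smul hf.contDiff, fun n hn x => ?_⟩
  have hsmul : iteratedFDeriv ℝ n (fun z => a • f z) x = a • iteratedFDeriv ℝ n f x :=
    iteratedFDeriv_const_smul_apply (hf.contDiff.contDiffAt.of_le (by exact_mod_cast hn))
  rw [hsmul, norm_smul, Real.norm_eq_abs]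
  gcongr
  exact hf.norm_iteratedFDeriv_le n hn x

lemma comp_const_sub (hf : DerivBound k f B) (w : E) : DerivBound k (fun z => f (w - z)) B := by
  refine ⟨hf.contDiff.comp (contDiff_const.sub contDiff_id), fun n hn x => ?_⟩
  have hneg := (LinearIsometryEquiv.neg ℝ (E := E)).norm_iteratedFDeriv_comp_right
    (fun z => f (w + z)) x n
  have hcomp : (fun z => f (w + z)) ∘ LinearIsometryEquiv.neg ℝ (E := E) = fun z => f (w - z) := by
    funext z; simp [sub_eq_add_neg]
  rw [hcomp, iteratedFDeriv_comp_add_left] at hneg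
  exact hneg ▸ hf.norm_iteratedFDeriv_le n hn _

lemma const_sub (hf : DerivBound k f B) (b : F) :
    DerivBound k (fun z => b - f z) (‖b‖ + B) := by
  refine ⟨contDiff_const.sub hf.contDiff, fun n hn x => ?_⟩
  have hsub : iteratedFDeriv ℝ n (fun z => b - f z) x
      = iteratedFDeriv ℝ n (fun _ : E => b) x - iteratedFDeriv ℝ n f x :=
    iteratedFDeriv_sub_apply contDiff_const.contDiffAt
      (hf.contDiff.contDiffAt.of_le (by exact_mod_cast hn))
  rw [hsub]
  refine (norm_sub_le _ _).trans (add_le_add ?_ (hf.norm_iteratedFDeriv_le n hn x))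
  rcases Nat.eq_zero_or_pos n with rfl | hpos
  · simp
  · simp [iteratedFDeriv_const_of_ne hpos.ne']

lemma normSq {G : Type*} [NormedAddCommGroup G] [InnerProductSpace ℝ G] {f : E → G}
    (hf : DerivBound k f B) : DerivBound k (fun z => ‖f z‖ ^ 2) (2 ^ k * B ^ 2) := by
  refine ⟨hf.contDiff.norm_sq ℝ, fun n hn x => ?_⟩
  have hinner : (fun z => ‖f z‖ ^ 2) = fun z => innerSL ℝ (f z) (f z) := by
    funext z; simp
  rw [hinner]
  refine ((innerSL ℝ (E := G)).norm_iteratedFDeriv_le_of_bilinear_of_le_one hf.contDiff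
    hf.contDiff x (by exact_mod_cast hn) (norm_innerSL_le ℝ)).trans ?_
  calc ∑ i ∈ Finset.range (n + 1), (n.choose i : ℝ) * ‖iteratedFDeriv ℝ i f x‖ *
        ‖iteratedFDeriv ℝ (n - i) f x‖
      ≤ ∑ i ∈ Finset.range (n + 1), (n.choose i : ℝ) * B ^ 2 := by
        refine Finset.sum_le_sum fun i hi => ?_
        have hin : i ≤ n := Nat.lt_succ_iff.1 (Finset.mem_range.1 hi)
        have hB := hf.nonneg
        rw [mul_assoc, sq]
        gcongr
        · exact hf.norm_iteratedFDeriv_le i (hin.trans hn) x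
        · exact hf.norm_iteratedFDeriv_le (n - i) ((Nat.sub_le _ _).trans hn) x
    _ = (2 : ℝ) ^ n * B ^ 2 := by
        rw [← Finset.sum_mul, ← Nat.cast_sum, Nat.sum_range_choose]; simp
    _ ≤ 2 ^ k * B ^ 2 := by gcongr; norm_num

lemma norm_taylor_le (hf : DerivBound k f B) (hk : 2 ≤ k) (z h : E) :
    ‖f (z + h) - f z - fderiv ℝ f z h‖ ≤ B * ‖h‖ ^ 2 := by
  have hf2 : ContDiff ℝ 2 f := hf.contDiff.of_le (by exact_mod_cast hk)
  have hd : Differentiable ℝ f := hf2.differentiable (by norm_num)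
  have hd2 : Differentiable ℝ (fderiv ℝ f) :=
    (hf2.fderiv_right (m := 1) (by norm_num)).differentiable (by norm_num)
  have hB : ∀ x, ‖fderiv ℝ (fderiv ℝ f) x‖ ≤ B := fun x => by
    rw [← norm_iteratedFDeriv_one, norm_iteratedFDeriv_fderiv]
    exact hf.norm_iteratedFDeriv_le 2 hk x
  have hlip : ∀ w, ‖fderiv ℝ f w - fderiv ℝ f z‖ ≤ B * ‖w - z‖ := fun w =>
    convex_univ.norm_image_sub_le_of_norm_fderiv_le (fun x _ => hd2 x) (fun x _ => hB x)
      (mem_univ z) (mem_univ w)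
  have hball : ∀ w ∈ Metric.closedBall z ‖h‖, ‖fderiv ℝ f w - fderiv ℝ f z‖ ≤ B * ‖h‖ :=
    fun w hw => (hlip w).trans
      (mul_le_mul_of_nonneg_left (by simpa [dist_eq_norm] using hw) hf.nonneg)
  simpa [sq, mul_assoc] using (convex_closedBall z ‖h‖).norm_image_sub_le_of_norm_fderiv_le'
    (fun x _ => hd x) hball (Metric.mem_closedBall_self (norm_nonneg h))
    (show z + h ∈ Metric.closedBall z ‖h‖ by simp [dist_eq_norm])

end DerivBound

lemma norm_le_sum_apply_stdVec {n : ℕ}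
    (T : ContinuousMultilinearMap ℝ (fun _ : Fin n => Space N) F) :
    ‖T‖ ≤ ∑ s : Fin n → Fin N, ‖T fun i => stdVec (s i)‖ := by
  refine T.opNorm_le_bound (by positivity) fun v => ?_
  have hv : v = fun i => ∑ k, v i k • (stdVec k : Space N) := by
    funext i
    ext l
    simp [Finset.sum_apply, Pi.single_apply]
  have hTv : T v = ∑ s : Fin n → Fin N, (∏ i, v i (s i)) • T fun i => stdVec (s i) := by
    conv_lhs => rw [hv]
    rw [T.map_sum]
    exact Finset.sum_congr rfl fun s _ => T.map_smul_univ _ _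
  rw [hTv, Finset.sum_mul]
  refine (norm_sum_le _ _).trans (Finset.sum_le_sum fun s _ => ?_)
  rw [norm_smul, mul_comm, norm_prod]
  gcongr with i
  exact PiLp.norm_apply_le (v i) (s i)

lemma enorm_iteratedFDeriv_stdVec_le_ckNorm {k n : ℕ} {f : Space N → F} (hn : n ≤ k)
    {s : Fin n → Fin N} (hs : Monotone s) (x : Space N) :
    ‖iteratedFDeriv ℝ n f x fun i => stdVec (s i)‖ₑ ≤ ckNorm k f := by
  refine (le_iSup (fun x => ‖iteratedFDeriv ℝ n f x fun i => stdVec (s i)‖ₑ) x).trans ?_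
  refine le_trans ?_ (Finset.single_le_sum (f := fun n => ∑ s : {s : Fin n → Fin N // Monotone s},
    ⨆ x, ‖iteratedFDeriv ℝ n f x (fun i => stdVec (s.1 i))‖ₑ) (fun _ _ => zero_le)
    (Finset.mem_range.2 (Nat.lt_succ_of_le hn)))
  exact Finset.single_le_sum (f := fun s : {s : Fin n → Fin N // Monotone s} =>
    ⨆ x, ‖iteratedFDeriv ℝ n f x (fun i => stdVec (s.1 i))‖ₑ) (fun _ _ => zero_le)
    (Finset.mem_univ ⟨s, hs⟩)

lemma norm_iteratedFDeriv_stdVec_le_ckNorm {k n : ℕ} {f : Space N → F} (hf : ContDiff ℝ k f)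
    (hfin : ckNorm k f < ⊤) (hn : n ≤ k) (s : Fin n → Fin N) (x : Space N) :
    ‖iteratedFDeriv ℝ n f x fun i => stdVec (s i)‖ ≤ (ckNorm k f).toReal := by
  have hsort : (iteratedFDeriv ℝ n f x fun i => stdVec (s (Tuple.sort s i)))
      = iteratedFDeriv ℝ n f x fun i => stdVec (s i) :=
    iteratedFDeriv_comp_perm (hf.of_le (by exact_mod_cast hn)) x (Tuple.sort s)
      fun i => stdVec (s i)
  rw [← hsort, ← toReal_enorm]
  exact ENNReal.toReal_mono hfin.ne
    (enorm_iteratedFDeriv_stdVec_le_ckNorm hn (Tuple.monotone_sort s) x)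

lemma natCast_pow_le_succ_pow (N : ℕ) {n k : ℕ} (hn : n ≤ k) : (N : ℝ) ^ n ≤ (N + 1 : ℝ) ^ k :=
  calc (N : ℝ) ^ n ≤ (N + 1 : ℝ) ^ n := by gcongr; linarith
    _ ≤ (N + 1 : ℝ) ^ k := by gcongr; linarith [N.cast_nonneg (α := ℝ)]

lemma DerivBound.of_ckNorm {k : ℕ} {f : Space N → F} (hf : ContDiff ℝ k f)
    (hfin : ckNorm k f < ⊤) : DerivBound k f ((N + 1 : ℝ) ^ k * (ckNorm k f).toReal) := by
  refine ⟨hf, fun n hn x => ?_⟩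
  calc ‖iteratedFDeriv ℝ n f x‖
      ≤ ∑ s : Fin n → Fin N, ‖iteratedFDeriv ℝ n f x fun i => stdVec (s i)‖ :=
        norm_le_sum_apply_stdVec _
    _ ≤ ∑ _s : Fin n → Fin N, (ckNorm k f).toReal :=
        Finset.sum_le_sum fun s _ => norm_iteratedFDeriv_stdVec_le_ckNorm hf hfin hn s x
    _ = (N : ℝ) ^ n * (ckNorm k f).toReal := by simp
    _ ≤ _ := by gcongr; exact natCast_pow_le_succ_pow N hn

/-- The constant in the bound of `ckNorm k` by the operator norms of the derivatives. -/
def ckConst (k N : ℕ) : ℝ := (k + 1) * (N + 1) ^ k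

lemma ckConst_pos (k N : ℕ) : 0 < ckConst k N := by unfold ckConst; positivity

lemma DerivBound.ckNorm_le {k : ℕ} {f : Space N → F} {B : ℝ} (hf : DerivBound k f B) :
    ckNorm k f ≤ ENNReal.ofReal (ckConst k N * B) := by
  have hcard : ∀ n ≤ k,
      (Fintype.card {s : Fin n → Fin N // Monotone s} : ℝ) ≤ (N + 1 : ℝ) ^ k := fun n hn => by
    refine le_trans ?_ (natCast_pow_le_succ_pow N hn)
    exact_mod_cast (Fintype.card_subtype_le _).trans (by simp)
  have hpartial : ∀ n ≤ k, ∀ s : Fin n → Fin N, ∀ x,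
      ‖iteratedFDeriv ℝ n f x fun i => stdVec (s i)‖ₑ ≤ ENNReal.ofReal B := fun n hn s x => by
    rw [← ofReal_norm]
    refine ENNReal.ofReal_le_ofReal (((iteratedFDeriv ℝ n f x).le_opNorm _).trans ?_)
    simpa using hf.norm_iteratedFDeriv_le n hn x
  calc ckNorm k f
      ≤ ∑ _n ∈ Finset.range (k + 1), ENNReal.ofReal ((N + 1) ^ k * B) := by
        refine Finset.sum_le_sum fun n hn => ?_
        have hnk : n ≤ k := Nat.lt_succ_iff.1 (Finset.mem_range.1 hn)
        refine (Finset.sum_le_sum fun s _ => iSup_le (hpartial n hnk s.1)).trans ?_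
        rw [Finset.sum_const, nsmul_eq_mul, ENNReal.ofReal_mul (by positivity), Finset.card_univ,
          ← ENNReal.ofReal_natCast]
        gcongr
        exact hcard n hnk
    _ = ENNReal.ofReal (ckConst k N * B) := by
        rw [Finset.sum_const, nsmul_eq_mul, Finset.card_range, ckConst, mul_assoc,
          ENNReal.ofReal_mul (by positivity : (0 : ℝ) ≤ k + 1), ← ENNReal.ofReal_natCast]
        push_cast
        rfl

lemma exists_bump (N k : ℕ) : ∃ (ζ : Space N → ℝ) (B : ℝ), DerivBound k ζ B ∧ ζ 0 = 1 ∧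
    (∀ x, 0 ≤ ζ x) ∧ (∀ x, ζ x ≤ 1) ∧ ∀ x, 1 ≤ ‖x‖ → ζ x = 0 := by
  let ζ : ContDiffBump (0 : Space N) := ⟨1 / 2, 1, by norm_num, by norm_num⟩
  have hζ : ContDiff ℝ k ζ := ζ.contDiff
  have hbdd : ∀ n : ℕ, n ≤ k → ∃ C, ∀ x, ‖iteratedFDeriv ℝ n ζ x‖ ≤ C := fun n hn =>
    (hζ.continuous_iteratedFDeriv (by exact_mod_cast hn)).bounded_above_of_compact_support
      (ζ.hasCompactSupport.iteratedFDeriv n)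
  choose! C hC using hbdd
  refine ⟨ζ, ∑ n ∈ Finset.range (k + 1), |C n|, ⟨hζ, fun n hn x => ?_⟩,
    ζ.one_of_mem_closedBall (by simp [ζ]), fun x => ζ.nonneg, fun x => ζ.le_one,
    fun x hx => ζ.zero_of_le_dist (by simpa [ζ] using hx)⟩
  exact ((hC n hn x).trans (le_abs_self _)).trans (Finset.single_le_sum (f := fun n => |C n|)
    (fun _ _ => abs_nonneg _) (Finset.mem_range.2 (Nat.lt_succ_of_le hn)))

end DerivBound

/-! ### The space `H^1` -/

section MemLp

variable {Ω F : Type*} [MeasurableSpace Ω] {μ : Measure Ω} [NormedAddCommGroup F] {f g : Ω → F}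

lemma integrable_normSq (hf : MemLp f 2 μ) : Integrable (fun x => ‖f x‖ ^ 2) μ :=
  (memLp_two_iff_integrable_sq_norm hf.1).1 hf

lemma integral_normSq_add_le (hf : MemLp f 2 μ) (hg : MemLp g 2 μ) :
    ∫ x, ‖f x + g x‖ ^ 2 ∂μ ≤ 2 * (∫ x, ‖f x‖ ^ 2 ∂μ) + 2 * ∫ x, ‖g x‖ ^ 2 ∂μ := by
  have hf2 := (integrable_normSq hf).const_mul 2
  have hg2 := (integrable_normSq hg).const_mul 2
  rw [← integral_const_mul, ← integral_const_mul, ← integral_add hf2 hg2]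
  refine integral_mono (integrable_normSq (hf.add hg)) (hf2.add hg2) fun x => ?_
  calc ‖f x + g x‖ ^ 2 ≤ (‖f x‖ + ‖g x‖) ^ 2 := by gcongr; exact norm_add_le _ _
    _ ≤ 2 * ‖f x‖ ^ 2 + 2 * ‖g x‖ ^ 2 := by linarith [add_sq_le (a := ‖f x‖) (b := ‖g x‖)]

lemma integral_normSq_sub_le (hf : MemLp f 2 μ) (hg : MemLp g 2 μ) :
    ∫ x, ‖f x - g x‖ ^ 2 ∂μ ≤ 2 * (∫ x, ‖f x‖ ^ 2 ∂μ) + 2 * ∫ x, ‖g x‖ ^ 2 ∂μ := by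
  simpa [sub_eq_add_neg] using integral_normSq_add_le hf hg.neg

lemma memLp_smul_imVec {u : Ω → ℂ} (hu : MemLp u 2 μ) (b : Space N) :
    MemLp (fun x => u x • imVec b) 2 μ :=
  hu.of_le_mul (c := ‖b‖) (hu.1.smul_const _) (Eventually.of_forall fun x => by
    rw [norm_smul, norm_imVec, mul_comm])

end MemLp

lemma memLp_comp_add {F : Type*} [NormedAddCommGroup F] {f : Space N → F}
    (hf : MemLp f 2 volume) (a : Space N) : MemLp (fun x => f (x + a)) 2 volume :=
  hf.comp_measurePreserving (measurePreserving_add_right volume a)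

lemma HasWeakGrad.h1NormSq_eq {u : Space N → ℂ} {g : Space N → EuclideanSpace ℂ (Fin N)}
    (hg : HasWeakGrad u g) : h1NormSq u = (∫ x, ‖g x‖ ^ 2) + ∫ x, ‖u x‖ ^ 2 := by
  rw [h1NormSq]
  congr 1
  exact integral_congr_ae (hg.weakGrad_ae_eq.mono fun x hx => congrArg (‖·‖ ^ 2) hx)

lemma h1NormSq_nonneg (u : Space N → ℂ) : 0 ≤ h1NormSq u :=
  add_nonneg (integral_nonneg fun _ => by positivity) (integral_nonneg fun _ => by positivity)

lemma integral_normSq_le_h1NormSq (u : Space N → ℂ) : ∫ x, ‖u x‖ ^ 2 ≤ h1NormSq u :=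
  le_add_of_nonneg_left (integral_nonneg fun _ => by positivity)

lemma weakGrad_congr {u v : Space N → ℂ} (hu : ∃ g, HasWeakGrad u g) (h : u =ᵐ[volume] v) :
    weakGrad u =ᵐ[volume] weakGrad v := by
  obtain ⟨g, hg⟩ := hu
  exact hg.weakGrad_ae_eq.trans (hg.congr h).weakGrad_ae_eq.symm

namespace MemH1

variable {u v : Space N → ℂ}

lemma hasWeakGrad (hu : MemH1 u) : HasWeakGrad u (weakGrad u) :=
  hu.2.choose_spec.1.weakGrad

lemma memLp_weakGrad (hu : MemH1 u) : MemLp (weakGrad u) 2 volume := by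
  obtain ⟨g, hg, hg2⟩ := hu.2
  exact hg2.ae_eq hg.weakGrad_ae_eq.symm

lemma sub (hu : MemH1 u) (hv : MemH1 v) : MemH1 fun x => u x - v x :=
  ⟨hu.1.sub hv.1, _, hu.hasWeakGrad.sub hv.hasWeakGrad, hu.memLp_weakGrad.sub hv.memLp_weakGrad⟩

lemma comp_add (hu : MemH1 u) (a : Space N) : MemH1 fun x => u (x + a) :=
  ⟨memLp_comp_add hu.1 a, _, hu.hasWeakGrad.comp_add a, memLp_comp_add hu.memLp_weakGrad a⟩

lemma planeWave_mul (hu : MemH1 u) (b : Space N) (κ : ℝ) :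
    MemH1 fun x => planeWave b κ x * u x := by
  have hw := (continuous_planeWave b κ).aestronglyMeasurable (μ := volume)
  have hgrad := hu.memLp_weakGrad.add (memLp_smul_imVec hu.1 b)
  exact ⟨hu.1.of_le (hw.mul hu.1.1) (Eventually.of_forall fun x => by simp), _,
    hu.hasWeakGrad.planeWave_mul b κ,
    hgrad.of_le (hw.smul hgrad.1) (Eventually.of_forall fun x => by
      rw [norm_smul, norm_planeWave, one_mul]; exact le_rfl)⟩

end MemH1

lemma h1NormSq_sub_le {u v : Space N → ℂ} (hu : MemH1 u) (hv : MemH1 v) :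
    h1NormSq (fun x => u x - v x) ≤ 2 * h1NormSq u + 2 * h1NormSq v := by
  rw [(hu.hasWeakGrad.sub hv.hasWeakGrad).h1NormSq_eq, h1NormSq, h1NormSq]
  linarith [integral_normSq_sub_le hu.memLp_weakGrad hv.memLp_weakGrad,
    integral_normSq_sub_le hu.1 hv.1]

lemma h1NormSq_comp_add {u : Space N → ℂ} (hu : MemH1 u) (a : Space N) :
    h1NormSq (fun x => u (x + a)) = h1NormSq u := by
  rw [(hu.hasWeakGrad.comp_add a).h1NormSq_eq, h1NormSq,
    integral_add_right_eq_self (fun x => ‖weakGrad u x‖ ^ 2) a,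
    integral_add_right_eq_self (fun x => ‖u x‖ ^ 2) a]

lemma h1NormSq_planeWave_mul_le {u : Space N → ℂ} (hu : MemH1 u) (b : Space N) (κ : ℝ) :
    h1NormSq (fun x => planeWave b κ x * u x) ≤ (2 + 2 * ‖b‖ ^ 2) * h1NormSq u := by
  have hgrad := integral_normSq_add_le hu.memLp_weakGrad (memLp_smul_imVec hu.1 b)
  have hu0 : 0 ≤ ∫ x, ‖u x‖ ^ 2 := integral_nonneg fun _ => by positivity
  have hg0 : 0 ≤ ∫ x, ‖weakGrad u x‖ ^ 2 := integral_nonneg fun _ => by positivity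
  rw [(hu.hasWeakGrad.planeWave_mul b κ).h1NormSq_eq, h1NormSq]
  simp only [norm_smul, norm_mul, norm_planeWave, norm_imVec, one_mul, mul_pow,
    integral_mul_const] at hgrad ⊢
  linarith [mul_nonneg (sq_nonneg ‖b‖) hg0]

/-! ### The magnetic gradient and the energy of the recentred solution -/

namespace DerivBound

variable {E F : Type*} [NormedAddCommGroup E] [NormedSpace ℝ E] [MeasurableSpace E] [BorelSpace E]
  [SecondCountableTopology E] {μ : Measure E} {k : ℕ} {B : ℝ}

lemma aestronglyMeasurable_comp_smul [NormedAddCommGroup F] [NormedSpace ℝ F] {f : E → F}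
    (hf : DerivBound k f B) (ε : ℝ) : AEStronglyMeasurable (fun x => f (ε • x)) μ :=
  (hf.continuous.comp (continuous_const_smul ε)).aestronglyMeasurable

lemma integrable_comp_smul_mul {f ρ : E → ℝ} (hf : DerivBound k f B) (hρ : Integrable ρ μ)
    (ε : ℝ) : Integrable (fun x => f (ε • x) * ρ x) μ :=
  hρ.bdd_mul (hf.aestronglyMeasurable_comp_smul ε) (Eventually.of_forall fun _ => hf.norm_le _)

lemma integrable_inner_comp_smul [NormedAddCommGroup F] [InnerProductSpace ℝ F] {f q : E → F}
    (hf : DerivBound k f B) (hq : Integrable q μ) (ε : ℝ) :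
    Integrable (fun x => inner ℝ (f (ε • x)) (q x)) μ := by
  refine (hq.norm.const_mul B).mono' ((hf.aestronglyMeasurable_comp_smul ε).inner hq.1)
    (Eventually.of_forall fun x => (norm_inner_le_norm _ _).trans ?_)
  gcongr
  exact hf.norm_le _

end DerivBound

lemma continuous_imVec : Continuous (imVec : Space N → EuclideanSpace ℂ (Fin N)) := by
  unfold imVec; fun_prop

lemma DerivBound.memLp_smul_imVec {k : ℕ} {A : Space N → Space N} {B : ℝ} (hA : DerivBound k A B)
    {u : Space N → ℂ} (hu : MemLp u 2 volume) (ε : ℝ) :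
    MemLp (fun x => u x • imVec (A (ε • x))) 2 volume :=
  hu.of_le_mul (c := B) (hu.1.smul
    (continuous_imVec.comp_aestronglyMeasurable (hA.aestronglyMeasurable_comp_smul ε)))
    (Eventually.of_forall fun x => by
      rw [norm_smul, norm_imVec, mul_comm]
      gcongr
      exact hA.norm_le _)

lemma weakGrad_eq_magGrad (A : Space N → Space N) (ε : ℝ) (u : Space N → ℂ) (x : Space N) :
    weakGrad u x = Complex.I • magGrad A ε u x + u x • imVec (A (ε • x)) := by
  ext k
  simp only [magGrad, PiLp.add_apply, PiLp.smul_apply, imVec_apply, smul_eq_mul]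
  linear_combination (weakGrad u x k) * Complex.I_sq

lemma MemHA.memH1 {P : Potentials N} {ε B : ℝ} {k : ℕ} {u : Fin m → Space N → ℂ}
    (hu : MemHA P ε u) (hA : DerivBound k P.A B) (j : Fin m) : MemH1 (u j) := by
  obtain ⟨huL, ⟨g, hg⟩, hmag, -⟩ := hu.1 j
  refine ⟨huL, _, hg.weakGrad, ?_⟩
  exact ((hmag.const_smul Complex.I).add (hA.memLp_smul_imVec huL ε)).ae_eq
    (Eventually.of_forall fun x => (weakGrad_eq_magGrad P.A ε (u j) x).symm)

/-- The magnetic current `Im(\bar u (∇u - i A(ε x) u))` of a scalar function, the summand of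
`momentum`. -/
def current (A : Space N → Space N) (ε : ℝ) (u : Space N → ℂ) (x : Space N) : Space N :=
  WithLp.toLp 2 fun k =>
    (conj (u x) * (weakGrad u x k - Complex.I * ((A (ε • x) k : ℝ) : ℂ) * u x)).im

lemma momentum_eq_sum (A : Space N → Space N) (ε : ℝ) (u : Fin m → Space N → ℂ) (x : Space N) :
    momentum A ε u x = ∑ j, current A ε (u j) x := by
  ext k
  simp [momentum, current]

lemma current_eq (A : Space N → Space N) (ε : ℝ) (u : Space N → ℂ) (x : Space N) :
    current A ε u x = WithLp.toLp 2 fun k =>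
      ((conj (u x) • Complex.I • magGrad A ε u x : EuclideanSpace ℂ (Fin N)) k).im := by
  ext k
  simp only [current, weakGrad_eq_magGrad A ε u x, PiLp.add_apply, PiLp.smul_apply, imVec_apply,
    smul_eq_mul]
  ring_nf

lemma norm_current_le (A : Space N → Space N) (ε : ℝ) (u : Space N → ℂ) (x : Space N) :
    ‖current A ε u x‖ ≤ ‖u x‖ * ‖magGrad A ε u x‖ := by
  calc ‖current A ε u x‖
      ≤ ‖(conj (u x) • Complex.I • magGrad A ε u x : EuclideanSpace ℂ (Fin N))‖ := by
        rw [current_eq, EuclideanSpace.norm_eq, EuclideanSpace.norm_eq]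
        gcongr with k
        exact Complex.abs_im_le_norm _
    _ = ‖u x‖ * ‖magGrad A ε u x‖ := by simp [norm_smul]

namespace MemH1

variable {A : Space N → Space N} {B : ℝ} {k : ℕ} {u : Space N → ℂ}

lemma memLp_magGrad (hu : MemH1 u) (hA : DerivBound k A B) (ε : ℝ) :
    MemLp (magGrad A ε u) 2 volume := by
  refine ((hu.memLp_weakGrad.sub (hA.memLp_smul_imVec hu.1 ε)).const_smul (-Complex.I)).ae_eq
    (Eventually.of_forall fun x => ?_)
  simp [weakGrad_eq_magGrad A ε u x, smul_smul]

lemma integrable_current (hu : MemH1 u) (hA : DerivBound k A B) (ε : ℝ) :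
    Integrable (current A ε u) := by
  have hmag := hu.memLp_magGrad hA ε
  have him : Continuous fun v : EuclideanSpace ℂ (Fin N) =>
      (WithLp.toLp 2 fun k => (v k).im : Space N) := by fun_prop
  have hmeas := him.comp_aestronglyMeasurable
    ((Complex.continuous_conj.comp_aestronglyMeasurable hu.1.1).smul (hmag.1.const_smul Complex.I))
  exact (MemLp.integrable_mul (p := 2) (q := 2) hu.1.norm hmag.norm).mono'
    (hmeas.congr (Eventually.of_forall fun x => (current_eq A ε u x).symm))
    (Eventually.of_forall fun x => norm_current_le A ε u x)

end MemH1

lemma integrable_density {u : Fin m → Space N → ℂ} (hu : ∀ j, MemLp (u j) 2 volume) :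
    Integrable (density u) :=
  integrable_finsetSum _ fun j _ => integrable_normSq (hu j)

lemma integrable_momentum {A : Space N → Space N} {B : ℝ} {k : ℕ} {u : Fin m → Space N → ℂ}
    (hu : ∀ j, MemH1 (u j)) (hA : DerivBound k A B) (ε : ℝ) : Integrable (momentum A ε u) := by
  simp only [funext (momentum_eq_sum A ε u)]
  exact integrable_finsetSum _ fun j _ => (hu j).integrable_current hA ε

lemma normSq_weakGrad_sub_smul_imVec (A : Space N → Space N) (ε : ℝ) (u : Space N → ℂ)
    (b x : Space N) :
    ‖weakGrad u x - u x • imVec b‖ ^ 2 = ‖magGrad A ε u x‖ ^ 2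
      + ‖b - A (ε • x)‖ ^ 2 * ‖u x‖ ^ 2 - 2 * inner ℝ (b - A (ε • x)) (current A ε u x) := by
  simp only [EuclideanSpace.norm_sq_eq, PiLp.inner_apply, Finset.sum_mul, Finset.mul_sum]
  rw [← Finset.sum_add_distrib, ← Finset.sum_sub_distrib]
  refine Finset.sum_congr rfl fun k _ => ?_
  simp only [magGrad, current, PiLp.sub_apply, PiLp.smul_apply, imVec_apply, smul_eq_mul,
    Complex.sq_norm, Complex.normSq_apply, Real.norm_eq_abs, sq_abs, RCLike.inner_apply]
  simp
  ring

lemma recentred_eq (A : Space N → Space N) (ε : ℝ) (u : Fin m → Space N → ℂ) (X Ξ : Space N)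
    (j : Fin m) : recentred A ε u X Ξ j = fun x =>
      planeWave (-(Ξ + A (ε • X))) (-inner ℝ Ξ X) x * u j (x + X) := by
  funext x
  rw [recentred, planeWave, ← Complex.exp_add]
  congr 2
  simp only [inner_add_right, inner_neg_left, inner_add_left]
  push_cast
  ring

lemma memH1_recentred {A : Space N → Space N} {ε : ℝ} {u : Fin m → Space N → ℂ} {X Ξ : Space N}
    {j : Fin m} (hu : MemH1 (u j)) : MemH1 (recentred A ε u X Ξ j) := by
  rw [recentred_eq]
  exact (hu.comp_add X).planeWave_mul _ _

lemma norm_recentred (A : Space N → Space N) (ε : ℝ) (u : Fin m → Space N → ℂ) (X Ξ : Space N)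
    (j : Fin m) (x : Space N) : ‖recentred A ε u X Ξ j x‖ = ‖u j (x + X)‖ := by
  rw [recentred_eq, norm_mul, norm_planeWave, one_mul]

lemma mass_recentred (A : Space N → Space N) (ε : ℝ) (u : Fin m → Space N → ℂ) (X Ξ : Space N)
    (j : Fin m) : mass (recentred A ε u X Ξ) j = mass u j := by
  simp only [mass, norm_recentred]
  exact integral_add_right_eq_self (fun x => ‖u j x‖ ^ 2) X

lemma totalMass_recentred (A : Space N → Space N) (ε : ℝ) (u : Fin m → Space N → ℂ)
    (X Ξ : Space N) : totalMass (recentred A ε u X Ξ) = totalMass u :=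
  Finset.sum_congr rfl fun j _ => mass_recentred A ε u X Ξ j

lemma weakGrad_recentred_ae_eq {A : Space N → Space N} {ε : ℝ} {u : Fin m → Space N → ℂ}
    {j : Fin m} (hu : MemH1 (u j)) (X Ξ : Space N) :
    weakGrad (recentred A ε u X Ξ j) =ᵐ[volume] fun x =>
      planeWave (-(Ξ + A (ε • X))) (-inner ℝ Ξ X) x •
        (weakGrad (u j) (x + X) - u j (x + X) • imVec (Ξ + A (ε • X))) := by
  have himVec : ∀ b : Space N, imVec (-b) = -imVec b := fun b => by ext k; simp
  rw [recentred_eq]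
  refine ((hu.hasWeakGrad.comp_add X).planeWave_mul _ _).weakGrad_ae_eq.trans
    (Eventually.of_forall fun x => ?_)
  simp only [himVec, smul_neg, ← sub_eq_add_neg]

lemma integral_normSq_weakGrad_recentred {A : Space N → Space N} {ε : ℝ}
    {u : Fin m → Space N → ℂ} {j : Fin m} (hu : MemH1 (u j)) (X Ξ : Space N) :
    ∫ x, ‖weakGrad (recentred A ε u X Ξ j) x‖ ^ 2
      = ∫ x, ‖weakGrad (u j) x - u j x • imVec (Ξ + A (ε • X))‖ ^ 2 := by
  rw [← integral_add_right_eq_self (fun x => ‖weakGrad (u j) x - _‖ ^ 2) X]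
  refine integral_congr_ae ?_
  filter_upwards [weakGrad_recentred_ae_eq (A := A) (ε := ε) hu X Ξ] with x hx
  rw [hx, norm_smul, norm_planeWave, one_mul]

/-- The contribution of the gauge `b` to the kinetic energy: half the kinetic energy of
`e^{-i b · x} u` minus half the magnetic kinetic energy of `u`. -/
def kineticDefect (A : Space N → Space N) (ε : ℝ) (u : Fin m → Space N → ℂ) (b : Space N) : ℝ :=
  (1 / 2) * (∫ x, ‖b - A (ε • x)‖ ^ 2 * density u x)
    - ∫ x, inner ℝ (b - A (ε • x)) (momentum A ε u x)

lemma sum_integral_normSq_weakGrad_recentred {A : Space N → Space N} {ε B : ℝ} {k : ℕ}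
    {u : Fin m → Space N → ℂ} (hu : ∀ j, MemH1 (u j)) (hA : DerivBound k A B) (X Ξ : Space N) :
    ∑ j, ∫ x, ‖weakGrad (recentred A ε u X Ξ j) x‖ ^ 2
      = ∑ j, (∫ x, ‖magGrad A ε (u j) x‖ ^ 2) + 2 * kineticDefect A ε u (Ξ + A (ε • X)) := by
  set b := Ξ + A (ε • X)
  have hb := hA.const_sub b
  have hmag : ∀ j, Integrable fun x => ‖magGrad A ε (u j) x‖ ^ 2 := fun j =>
    integrable_normSq ((hu j).memLp_magGrad hA ε)
  have hsq : ∀ j, Integrable fun x => ‖b - A (ε • x)‖ ^ 2 * ‖u j x‖ ^ 2 := fun j =>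
    hb.normSq.integrable_comp_smul_mul (integrable_normSq (hu j).1) ε
  have hcur : ∀ j, Integrable fun x => inner ℝ (b - A (ε • x)) (current A ε (u j) x) := fun j =>
    hb.integrable_inner_comp_smul ((hu j).integrable_current hA ε) ε
  have hsq_sum : ∫ x, ‖b - A (ε • x)‖ ^ 2 * density u x
      = ∑ j, ∫ x, ‖b - A (ε • x)‖ ^ 2 * ‖u j x‖ ^ 2 := by
    rw [← integral_finsetSum _ fun j _ => hsq j]
    simp only [density, Finset.mul_sum]
  have hcur_sum : ∫ x, inner ℝ (b - A (ε • x)) (momentum A ε u x)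
      = ∑ j, ∫ x, inner ℝ (b - A (ε • x)) (current A ε (u j) x) := by
    rw [← integral_finsetSum _ fun j _ => hcur j]
    simp only [momentum_eq_sum, inner_sum]
  have hj : ∀ j, ∫ x, ‖weakGrad (recentred A ε u X Ξ j) x‖ ^ 2
      = (∫ x, ‖magGrad A ε (u j) x‖ ^ 2) + (∫ x, ‖b - A (ε • x)‖ ^ 2 * ‖u j x‖ ^ 2)
        - 2 * ∫ x, inner ℝ (b - A (ε • x)) (current A ε (u j) x) := fun j => by
    have hadd : Integrable fun x =>
        ‖magGrad A ε (u j) x‖ ^ 2 + ‖b - A (ε • x)‖ ^ 2 * ‖u j x‖ ^ 2 := (hmag j).add (hsq j)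
    simp only [integral_normSq_weakGrad_recentred (hu j), normSq_weakGrad_sub_smul_imVec A ε (u j)]
    rw [integral_sub hadd ((hcur j).const_mul 2), integral_add (hmag j) (hsq j),
      integral_const_mul]
  rw [kineticDefect, hsq_sum, hcur_sum, Finset.sum_congr rfl fun j _ => hj j,
    Finset.sum_sub_distrib, Finset.sum_add_distrib, ← Finset.mul_sum]
  ring

/-- The interaction energy `∬ Φ(ε(x - y)) a(x) b(y) dx dy` of two densities. -/
def interaction (Φ : Space N → ℝ) (ε : ℝ) (a b : Space N → ℝ) : ℝ :=
  ∫ x, ∫ y, Φ (ε • (x - y)) * a x * b y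

/-- The nonlocal part of the total energy, with the opposite sign. -/
def nonlocalEnergy (K : Couplings m) (Φ : Space N → ℝ) (ε : ℝ) (u : Fin m → Space N → ℂ) : ℝ :=
  (1 / 2) * ∑ j, K.β j * interaction Φ ε (fun x => ‖u j x‖ ^ 2) (fun x => ‖u j x‖ ^ 2)
  + (1 / 2) * ∑ j, ∑ i ∈ Finset.univ.erase j,
      K.w i j * interaction Φ ε (fun x => ‖u i x‖ ^ 2) (fun x => ‖u j x‖ ^ 2)

/-- The local nonlinear part of the energy `𝓔`, with the opposite sign. -/
def localEnergy (K : Couplings m) (u : Fin m → Space N → ℂ) : ℝ :=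
  ∑ j, K.α j / (K.p + 1) * (∫ x, ‖u j x‖ ^ (2 * K.p + 2))
  + ∑ j, ∑ i ∈ Finset.univ.erase j,
      K.γ i j / (K.p + 1) * (∫ x, ‖u i x‖ ^ (K.p + 1) * ‖u j x‖ ^ (K.p + 1))

lemma energy_eq (K : Couplings m) (u : Fin m → Space N → ℂ) :
    energy K u = (1 / 2) * ∑ j, (∫ x, ‖weakGrad (u j) x‖ ^ 2) - localEnergy K u := by
  rw [energy, localEnergy]
  ring

lemma totalEnergy_eq (K : Couplings m) {P : Potentials N} {B : ℝ} {k : ℕ}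
    (hV : DerivBound k P.V B) {u : Fin m → Space N → ℂ} (hu : ∀ j, MemLp (u j) 2 volume) (ε : ℝ) :
    totalEnergy K P ε u = (1 / 2) * ∑ j, (∫ x, ‖magGrad P.A ε (u j) x‖ ^ 2)
      + (∫ x, P.V (ε • x) * density u x) - localEnergy K u - nonlocalEnergy K P.Φ ε u := by
  have hV_sum : ∫ x, P.V (ε • x) * density u x = ∑ j, ∫ x, P.V (ε • x) * ‖u j x‖ ^ 2 := by
    rw [← integral_finsetSum _ fun j _ =>
      hV.integrable_comp_smul_mul (integrable_normSq (hu j)) ε]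
    simp only [density, Finset.mul_sum]
  simp only [totalEnergy, localEnergy, nonlocalEnergy, interaction, hV_sum, div_eq_mul_inv,
    Finset.mul_sum]
  ring_nf

lemma localEnergy_recentred (K : Couplings m) (A : Space N → Space N) (ε : ℝ)
    (u : Fin m → Space N → ℂ) (X Ξ : Space N) :
    localEnergy K (recentred A ε u X Ξ) = localEnergy K u := by
  have hself : ∀ j, ∫ x, ‖u j (x + X)‖ ^ (2 * K.p + 2) = ∫ x, ‖u j x‖ ^ (2 * K.p + 2) := fun j =>
    integral_add_right_eq_self (fun x => ‖u j x‖ ^ (2 * K.p + 2)) X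
  have hcross : ∀ i j, ∫ x, ‖u i (x + X)‖ ^ (K.p + 1) * ‖u j (x + X)‖ ^ (K.p + 1)
      = ∫ x, ‖u i x‖ ^ (K.p + 1) * ‖u j x‖ ^ (K.p + 1) := fun i j =>
    integral_add_right_eq_self (fun x => ‖u i x‖ ^ (K.p + 1) * ‖u j x‖ ^ (K.p + 1)) X
  simp only [localEnergy, norm_recentred, hself, hcross]

lemma energy_recentred (K : Couplings m) {P : Potentials N} {BA BV : ℝ} {k : ℕ}
    (hA : DerivBound k P.A BA) (hV : DerivBound k P.V BV) {u : Fin m → Space N → ℂ}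
    (hu : ∀ j, MemH1 (u j)) (ε : ℝ) (X Ξ : Space N) :
    energy K (recentred P.A ε u X Ξ) = totalEnergy K P ε u - (∫ x, P.V (ε • x) * density u x)
      + nonlocalEnergy K P.Φ ε u + kineticDefect P.A ε u (Ξ + P.A (ε • X)) := by
  rw [energy_eq, totalEnergy_eq K hV (fun j => (hu j).1), localEnergy_recentred,
    sum_integral_normSq_weakGrad_recentred hu hA]
  ring

lemma energy_congr (K : Couplings m) {u v : Fin m → Space N → ℂ} (hu : ∀ j, MemH1 (u j))
    (h : ∀ j, u j =ᵐ[volume] v j) : energy K u = energy K v := by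
  have hgrad : ∀ j, ∫ x, ‖weakGrad (u j) x‖ ^ 2 = ∫ x, ‖weakGrad (v j) x‖ ^ 2 := fun j =>
    integral_congr_ae ((weakGrad_congr ⟨_, (hu j).hasWeakGrad⟩ (h j)).mono
      fun x hx => congrArg (‖·‖ ^ 2) hx)
  have hself : ∀ j, ∫ x, ‖u j x‖ ^ (2 * K.p + 2) = ∫ x, ‖v j x‖ ^ (2 * K.p + 2) := fun j =>
    integral_congr_ae ((h j).mono fun x hx => congrArg (‖·‖ ^ (2 * K.p + 2)) hx)
  have hcross : ∀ i j, ∫ x, ‖u i x‖ ^ (K.p + 1) * ‖u j x‖ ^ (K.p + 1)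
      = ∫ x, ‖v i x‖ ^ (K.p + 1) * ‖v j x‖ ^ (K.p + 1) := fun i j => by
    refine integral_congr_ae ?_
    filter_upwards [h i, h j] with x hi hj using by rw [hi, hj]
  simp only [energy, hgrad, hself, hcross]

/-! ### The quantity `Ω` -/

lemma density_nonneg (u : Fin m → Space N → ℂ) (x : Space N) : 0 ≤ density u x :=
  Finset.sum_nonneg fun _ _ => by positivity

lemma integral_density {u : Fin m → Space N → ℂ} (hu : ∀ j, MemLp (u j) 2 volume) :
    ∫ x, density u x = totalMass u := by
  simp only [density, totalMass, mass]
  exact integral_finsetSum _ fun j _ => integrable_normSq (hu j)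

lemma totalMass_nonneg (u : Fin m → Space N → ℂ) : 0 ≤ totalMass u :=
  Finset.sum_nonneg fun _ _ => integral_nonneg fun _ => by positivity

/-- The norm of the functional `φ ↦ densityDefect ε M u X φ` in the dual of `C³`. -/
def densityDefectNorm (ε M : ℝ) (u : Fin m → Space N → ℂ) (X : Space N) : ℝ :=
  sSup {d : ℝ | ∃ φ : Space N → ℝ, ContDiff ℝ 3 φ ∧ ckNorm 3 φ ≤ 1 ∧
    d = |densityDefect ε M u X φ|}

/-- The part of `Ω` that controls the energy of the recentred function: the defects of the momentum,
of the density and of `A · q^A`, without the term in the cutoff `χ`. -/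
def reducedOmega (A : Space N → Space N) (ε M : ℝ) (u : Fin m → Space N → ℂ) (X Ξ : Space N) : ℝ :=
  ‖(∫ x, momentum A ε u x) - M • Ξ‖ + densityDefectNorm ε M u X + rhoA A ε M u X Ξ

section Omega

variable {A : Space N → Space N} {ε M : ℝ} {u : Fin m → Space N → ℂ} {X Ξ : Space N}

lemma densityDefectNorm_nonneg : 0 ≤ densityDefectNorm ε M u X :=
  Real.sSup_nonneg fun _ ⟨_, _, _, hd⟩ => hd ▸ abs_nonneg _

lemma rhoA_nonneg : 0 ≤ rhoA A ε M u X Ξ :=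
  abs_nonneg _

lemma norm_integral_momentum_sub_le_reducedOmega :
    ‖(∫ x, momentum A ε u x) - M • Ξ‖ ≤ reducedOmega A ε M u X Ξ := by
  rw [reducedOmega, add_assoc]
  exact le_add_of_nonneg_right (add_nonneg densityDefectNorm_nonneg rhoA_nonneg)

lemma reducedOmega_nonneg : 0 ≤ reducedOmega A ε M u X Ξ :=
  (norm_nonneg _).trans norm_integral_momentum_sub_le_reducedOmega

lemma rhoA_le_reducedOmega : rhoA A ε M u X Ξ ≤ reducedOmega A ε M u X Ξ :=
  le_add_of_nonneg_left (add_nonneg (norm_nonneg _) densityDefectNorm_nonneg)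

lemma densityDefectNorm_le_reducedOmega :
    densityDefectNorm ε M u X ≤ reducedOmega A ε M u X Ξ :=
  (le_add_of_nonneg_left (norm_nonneg _)).trans (le_add_of_nonneg_right rhoA_nonneg)

lemma reducedOmega_le_omega (χ : Space N → ℝ) :
    reducedOmega A ε M u X Ξ ≤ omega A χ ε M u X Ξ := by
  rw [reducedOmega, omega, omegaHat, densityDefectNorm]
  exact add_le_add (le_add_of_nonneg_right (norm_nonneg _)) le_rfl

lemma abs_densityDefect_le_of_abs_le_one (hu : ∀ j, MemLp (u j) 2 volume) {f : Space N → ℝ}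
    (hf : ∀ x, |f x| ≤ 1) : |densityDefect ε M u X f| ≤ (∫ x, density u x) + |M| := by
  refine (abs_sub _ _).trans (add_le_add ?_ ?_)
  · refine abs_integral_le_integral_abs.trans (integral_mono_of_nonneg
      (Eventually.of_forall fun x => abs_nonneg _) (integrable_density hu)
      (Eventually.of_forall fun x => ?_))
    simp only [abs_mul, abs_of_nonneg (density_nonneg u x)]
    exact mul_le_of_le_one_left (density_nonneg u x) (hf _)
  · rw [abs_mul]
    exact mul_le_of_le_one_right (abs_nonneg _) (hf _)

lemma abs_le_one_of_ckNorm_le_one {k : ℕ} {f : Space N → ℝ} (hf : ckNorm k f ≤ 1) (x : Space N) :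
    |f x| ≤ 1 := by
  have hx := (enorm_iteratedFDeriv_stdVec_le_ckNorm k.zero_le (s := Fin.elim0)
    (fun i => i.elim0) x).trans hf
  rw [iteratedFDeriv_zero_apply, ← ofReal_norm, ENNReal.ofReal_le_one] at hx
  exact hx

lemma abs_densityDefect_le_densityDefectNorm (hu : ∀ j, MemLp (u j) 2 volume) {f : Space N → ℝ}
    (hf : ContDiff ℝ 3 f) (hf1 : ckNorm 3 f ≤ 1) :
    |densityDefect ε M u X f| ≤ densityDefectNorm ε M u X := by
  refine le_csSup ⟨(∫ x, density u x) + |M|, ?_⟩ ⟨f, hf, hf1, rfl⟩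
  rintro d ⟨φ, -, hφ1, rfl⟩
  exact abs_densityDefect_le_of_abs_le_one hu (abs_le_one_of_ckNorm_le_one hφ1)

lemma DerivBound.abs_densityDefect_le {f : Space N → ℝ} {B : ℝ} (hf : DerivBound 3 f B)
    (hu : ∀ j, MemLp (u j) 2 volume) :
    |densityDefect ε M u X f| ≤ ckConst 3 N * B * densityDefectNorm ε M u X := by
  rcases hf.nonneg.eq_or_lt with rfl | hB
  · have hf0 : ∀ x, f x = 0 := fun x => norm_le_zero_iff.1 (hf.norm_le x)
    simp [densityDefect, hf0]
  set D := ckConst 3 N * B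
  have hD : 0 < D := mul_pos (ckConst_pos 3 N) hB
  have hunit : ckNorm 3 (fun z => D⁻¹ • f z) ≤ 1 := by
    refine (hf.const_smul D⁻¹).ckNorm_le.trans ?_
    rw [abs_of_pos (inv_pos.2 hD), mul_left_comm, inv_mul_cancel₀ hD.ne', ENNReal.ofReal_one]
  have hscaled : densityDefect ε M u X (fun z => D⁻¹ • f z) = D⁻¹ * densityDefect ε M u X f := by
    simp only [densityDefect, smul_eq_mul, mul_assoc, integral_const_mul]
    ring
  have hle := abs_densityDefect_le_densityDefectNorm (ε := ε) (M := M) (X := X) hu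
    (hf.const_smul D⁻¹).contDiff hunit
  rwa [hscaled, abs_mul, abs_of_pos (inv_pos.2 hD), inv_mul_le_iff₀ hD] at hle

end Omega

/-! ### Even weights -/

/-- A nonnegative even weight with finite mass and finite second moment. Here it is the density
`r_j²` of a component of the ground state. -/
structure EvenWeight {E : Type*} [NormedAddCommGroup E] [MeasurableSpace E] (μ : Measure E)
    (ρ : E → ℝ) : Prop where
  nonneg : ∀ x, 0 ≤ ρ x
  integrable : Integrable ρ μ
  moment : Integrable (fun x => ‖x‖ ^ 2 * ρ x) μ
  even : ∀ x, ρ (-x) = ρ x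

namespace EvenWeight

variable {E : Type*} [NormedAddCommGroup E] [MeasurableSpace E] {μ : Measure E}

lemma moment_nonneg {ρ : E → ℝ} (hρ : EvenWeight μ ρ) : 0 ≤ ∫ x, ‖x‖ ^ 2 * ρ x ∂μ :=
  integral_nonneg fun x => mul_nonneg (by positivity) (hρ.nonneg x)

protected lemma sum {ι : Type*} [Fintype ι] {ρ : ι → E → ℝ} (hρ : ∀ j, EvenWeight μ (ρ j)) :
    EvenWeight μ fun x => ∑ j, ρ j x where
  nonneg x := Finset.sum_nonneg fun j _ => (hρ j).nonneg x
  integrable := integrable_finsetSum _ fun j _ => (hρ j).integrable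
  moment := by
    simp only [Finset.mul_sum]
    exact integrable_finsetSum _ fun j _ => (hρ j).moment
  even x := Finset.sum_congr rfl fun j _ => (hρ j).even x

variable [NormedSpace ℝ E] [BorelSpace E] {ρ : E → ℝ}

lemma integrable_clm_mul (hρ : EvenWeight μ ρ) (L : E →L[ℝ] ℝ) :
    Integrable (fun x => L x * ρ x) μ := by
  refine ((hρ.integrable.add hρ.moment).const_mul ‖L‖).mono'
    (L.continuous.aestronglyMeasurable.mul hρ.integrable.1) (Eventually.of_forall fun x => ?_)
  have hρx := hρ.nonneg x
  rw [norm_mul, Real.norm_of_nonneg hρx, Pi.add_apply]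
  calc ‖L x‖ * ρ x ≤ ‖L‖ * (1 + ‖x‖ ^ 2) * ρ x := by
        gcongr
        refine (L.le_opNorm x).trans ?_
        gcongr
        nlinarith [sq_nonneg (‖x‖ - 1)]
    _ = ‖L‖ * (ρ x + ‖x‖ ^ 2 * ρ x) := by ring

lemma integral_clm_mul_eq_zero [μ.IsNegInvariant] (hρ : EvenWeight μ ρ) (L : E →L[ℝ] ℝ) :
    ∫ x, L x * ρ x ∂μ = 0 := by
  have hneg := integral_neg_eq_self (fun x => L x * ρ x) μ
  simp only [hρ.even, map_neg, neg_mul, integral_neg] at hneg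
  linarith

lemma abs_integral_sub_le [SecondCountableTopology E] [μ.IsNegInvariant] (hρ : EvenWeight μ ρ)
    {f : E → ℝ} {B : ℝ} {k : ℕ} (hf : DerivBound k f B) (hk : 2 ≤ k) (z : E) (ε : ℝ) :
    |(∫ x, f (z + ε • x) * ρ x ∂μ) - f z * ∫ x, ρ x ∂μ|
      ≤ B * ε ^ 2 * ∫ x, ‖x‖ ^ 2 * ρ x ∂μ := by
  set L := ε • fderiv ℝ f z
  have hfρ : Integrable (fun x => f (z + ε • x) * ρ x) μ :=
    hρ.integrable.bdd_mul (hf.continuous.comp (by fun_prop)).aestronglyMeasurable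
      (Eventually.of_forall fun x => hf.norm_le _)
  have hfzρ : Integrable (fun x => f z * ρ x) μ := hρ.integrable.const_mul _
  have hsub : Integrable (fun x => f (z + ε • x) * ρ x - f z * ρ x) μ := hfρ.sub hfzρ
  have hremainder : (∫ x, f (z + ε • x) * ρ x ∂μ) - f z * ∫ x, ρ x ∂μ
      = ∫ x, (f (z + ε • x) - f z - L x) * ρ x ∂μ := by
    simp only [sub_mul]
    rw [integral_sub hsub (hρ.integrable_clm_mul L), integral_sub hfρ hfzρ,
      hρ.integral_clm_mul_eq_zero, integral_const_mul, sub_zero]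
  rw [hremainder, ← integral_const_mul]
  refine abs_integral_le_integral_abs.trans (integral_mono_of_nonneg
    (Eventually.of_forall fun x => abs_nonneg _) (hρ.moment.const_mul _)
    (Eventually.of_forall fun x => ?_))
  simp only [abs_mul, abs_of_nonneg (hρ.nonneg x)]
  calc |f (z + ε • x) - f z - L x| * ρ x ≤ B * ‖ε • x‖ ^ 2 * ρ x := by
        gcongr
        · exact hρ.nonneg x
        · simpa [L] using hf.norm_taylor_le hk z (ε • x)
    _ = B * ε ^ 2 * (‖x‖ ^ 2 * ρ x) := by
        rw [norm_smul, mul_pow, Real.norm_eq_abs, sq_abs]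
        ring

end EvenWeight

/-! ### The nonlocal energy -/

/-- The convolution `Φ(ε ·) * b` as a function of the macroscopic variable `z = ε x`. -/
def smeared (Φ : Space N → ℝ) (ε : ℝ) (b : Space N → ℝ) (z : Space N) : ℝ :=
  ∫ y, Φ (z - ε • y) * b y

lemma interaction_eq_integral_smeared (Φ : Space N → ℝ) (ε : ℝ) (a b : Space N → ℝ) :
    interaction Φ ε a b = ∫ x, smeared Φ ε b (ε • x) * a x := by
  have hswap : ∀ x y, Φ (ε • (x - y)) * a x * b y = Φ (ε • x - ε • y) * b y * a x :=
    fun x y => by rw [smul_sub]; ring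
  simp only [interaction, hswap, integral_mul_const, smeared]

section Interaction

variable {Φ a b : Space N → ℝ} {B : ℝ} {k : ℕ}

lemma continuous_smeared (hΦ : DerivBound k Φ B) (hb : Integrable b) (ε : ℝ) :
    Continuous (smeared Φ ε b) := by
  refine continuous_of_dominated (bound := fun y => B * ‖b y‖) (fun z => ?_)
    (fun z => Eventually.of_forall fun y => ?_) (hb.norm.const_mul B)
    (Eventually.of_forall fun y => (hΦ.continuous.comp (by fun_prop)).mul continuous_const)
  · exact (hΦ.continuous.comp (by fun_prop)).aestronglyMeasurable.mul hb.1
  · rw [norm_mul]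
    gcongr
    exact hΦ.norm_le _

lemma norm_smeared_le (hΦ : DerivBound k Φ B) (hb : Integrable b) (ε : ℝ) (z : Space N) :
    ‖smeared Φ ε b z‖ ≤ B * ∫ y, ‖b y‖ := by
  rw [← integral_const_mul]
  refine norm_integral_le_of_norm_le (hb.norm.const_mul B) (Eventually.of_forall fun y => ?_)
  rw [norm_mul]
  gcongr
  exact hΦ.norm_le _

lemma integrable_smeared_mul (hΦ : DerivBound k Φ B) (ha : Integrable a) (hb : Integrable b)
    (ε : ℝ) : Integrable fun x => smeared Φ ε b (ε • x) * a x :=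
  ha.bdd_mul ((continuous_smeared hΦ hb ε).comp (continuous_const_smul ε)).aestronglyMeasurable
    (Eventually.of_forall fun _ => norm_smeared_le hΦ hb ε _)

lemma interaction_le_of_smeared_le (hΦ : DerivBound k Φ B) (ha : Integrable a)
    (hb : Integrable b) (ha0 : ∀ x, 0 ≤ a x) {ε : ℝ} {H : Space N → ℝ}
    (hH : ∀ z, smeared Φ ε b z ≤ H z) (hHa : Integrable fun x => H (ε • x) * a x) :
    interaction Φ ε a b ≤ ∫ x, H (ε • x) * a x := by
  rw [interaction_eq_integral_smeared]
  exact integral_mono (integrable_smeared_mul hΦ ha hb ε) hHa fun x =>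
    mul_le_mul_of_nonneg_right (hH _) (ha0 x)

lemma interaction_le_of_le (hΦ : DerivBound k Φ B) (ha : Integrable a) (hb : Integrable b)
    (ha0 : ∀ x, 0 ≤ a x) (hb0 : ∀ x, 0 ≤ b x) {c : ℝ} (hc : ∀ z, Φ z ≤ c) (ε : ℝ) :
    interaction Φ ε a b ≤ c * (∫ x, a x) * ∫ x, b x := by
  have hsmeared : ∀ z, smeared Φ ε b z ≤ c * ∫ x, b x := fun z => by
    rw [← integral_const_mul]
    exact integral_mono (hb.bdd_mul (hΦ.continuous.comp (by fun_prop)).aestronglyMeasurable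
      (Eventually.of_forall fun _ => hΦ.norm_le _)) (hb.const_mul c) fun y =>
      mul_le_mul_of_nonneg_right (hc _) (hb0 y)
  refine (interaction_le_of_smeared_le hΦ ha hb ha0 hsmeared (ha.const_mul _)).trans_eq ?_
  rw [integral_const_mul, mul_right_comm]

lemma le_interaction (hΦ : DerivBound k Φ B) (hk : 2 ≤ k) (ha : EvenWeight volume a)
    (hb : EvenWeight volume b) (ε : ℝ) :
    Φ 0 * (∫ x, a x) * (∫ x, b x) - B * ε ^ 2 *
        ((∫ x, ‖x‖ ^ 2 * a x) * (∫ x, b x) + (∫ x, a x) * ∫ x, ‖x‖ ^ 2 * b x)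
      ≤ interaction Φ ε a b := by
  set massB := ∫ x, b x
  set momentB := ∫ x, ‖x‖ ^ 2 * b x
  have hmassB : 0 ≤ massB := integral_nonneg hb.nonneg
  have hΦa := hΦ.integrable_comp_smul_mul ha.integrable ε
  have hle_smeared : ∀ z, Φ z * massB - B * ε ^ 2 * momentB ≤ smeared Φ ε b z := fun z => by
    have h := (abs_le.1 (hb.abs_integral_sub_le hΦ hk z (-ε))).1
    simp only [neg_smul, ← sub_eq_add_neg, neg_sq] at h
    rw [smeared]
    linarith
  have hle_integral : massB * (∫ x, Φ (ε • x) * a x) - B * ε ^ 2 * momentB * (∫ x, a x)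
      ≤ interaction Φ ε a b := by
    rw [interaction_eq_integral_smeared, ← integral_const_mul, ← integral_const_mul,
      ← integral_sub (hΦa.const_mul _) (ha.integrable.const_mul _)]
    refine integral_mono ((hΦa.const_mul _).sub (ha.integrable.const_mul _))
      (integrable_smeared_mul hΦ ha.integrable hb.integrable ε) fun x => ?_
    refine le_trans (le_of_eq ?_) (mul_le_mul_of_nonneg_right (hle_smeared (ε • x)) (ha.nonneg x))
    ring
  have ha_avg := (abs_le.1 (ha.abs_integral_sub_le hΦ hk 0 ε)).1
  simp only [zero_add] at ha_avg
  linarith [mul_le_mul_of_nonneg_left ha_avg hmassB]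

end Interaction

lemma interaction_density_le {Φ : Space N → ℝ} {B : ℝ} (hΦ : DerivBound 3 Φ B)
    {u : Fin m → Space N → ℂ} (hu : ∀ j, MemLp (u j) 2 volume) (ε : ℝ) (X : Space N) :
    interaction Φ ε (density u) (density u) ≤ Φ 0 * totalMass u * totalMass u
      + 2 * totalMass u * (ckConst 3 N * B) * densityDefectNorm ε (totalMass u) u X := by
  have hM := totalMass_nonneg u
  set M := totalMass u with hMdef
  set δ := ckConst 3 N * B * densityDefectNorm ε M u X with hδ
  have hdens := integrable_density hu
  have hshift := (hΦ.comp_sub_const (ε • X)).integrable_comp_smul_mul hdens ε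
  have hsmeared : ∀ z, smeared Φ ε (density u) z ≤ M * Φ (z - ε • X) + δ := fun z => by
    have h := (abs_le.1 ((hΦ.comp_const_sub z).abs_densityDefect_le (ε := ε) (M := M) (X := X)
      hu)).2
    rw [densityDefect] at h
    rw [smeared]
    linarith
  have hsplit : ∀ x, (M * Φ (ε • x - ε • X) + δ) * density u x
      = M * (Φ (ε • x - ε • X) * density u x) + δ * density u x := fun x => by ring
  have hint : Integrable fun x =>
      M * (Φ (ε • x - ε • X) * density u x) + δ * density u x :=
    (hshift.const_mul M).add (hdens.const_mul δ)
  have hle := interaction_le_of_smeared_le hΦ hdens hdens (density_nonneg u) hsmeared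
    (by simpa only [hsplit] using hint)
  simp only [hsplit] at hle
  rw [integral_add (hshift.const_mul M) (hdens.const_mul δ), integral_const_mul,
    integral_const_mul, integral_density hu, ← hMdef] at hle
  have hcentre := (abs_le.1 ((hΦ.comp_sub_const (ε • X)).abs_densityDefect_le (ε := ε) (M := M)
    (X := X) hu)).2
  rw [densityDefect, sub_self, ← hδ] at hcentre
  linarith [mul_le_mul_of_nonneg_left hcentre hM]

lemma interaction_normSq_le {Φ : Space N → ℝ} {B : ℝ} (hΦ : DerivBound 3 Φ B)
    (hmax : 1 < m → ∀ z, Φ z ≤ Φ 0) {u : Fin m → Space N → ℂ}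
    (hu : ∀ j, MemLp (u j) 2 volume) (ε : ℝ) (X : Space N) (i j : Fin m) :
    interaction Φ ε (fun x => ‖u i x‖ ^ 2) (fun x => ‖u j x‖ ^ 2) ≤ Φ 0 * mass u i * mass u j
      + 2 * totalMass u * (ckConst 3 N * B) * densityDefectNorm ε (totalMass u) u X := by
  by_cases hm : 1 < m
  · refine (interaction_le_of_le hΦ (integrable_normSq (hu i)) (integrable_normSq (hu j))
      (fun x => by positivity) (fun x => by positivity) (hmax hm) ε).trans
      (le_add_of_nonneg_right ?_)
    have := totalMass_nonneg u
    have := ckConst_pos 3 N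
    have := hΦ.nonneg
    have := densityDefectNorm_nonneg (ε := ε) (M := totalMass u) (u := u) (X := X)
    positivity
  · obtain rfl : m = 1 := by have := i.pos; lia
    have hdensity : ∀ i, (fun x => ‖u i x‖ ^ 2) = density u := fun i => by
      obtain rfl : i = 0 := Subsingleton.elim _ _
      funext x
      simp [density]
    have hmass : ∀ i, mass u i = totalMass u := fun i => by
      obtain rfl : i = 0 := Subsingleton.elim _ _
      simp [totalMass]
    rw [hdensity, hdensity, hmass, hmass]
    exact interaction_density_le hΦ hu ε X

/-- The quadratic form in the coupling constants `β_j`, `ω_{ij}` through which the pairwise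
interactions enter the energy. -/
def couplingSum (K : Couplings m) (I : Fin m → Fin m → ℝ) : ℝ :=
  (1 / 2) * ∑ j, K.β j * I j j
  + (1 / 2) * ∑ j, ∑ i ∈ Finset.univ.erase j, K.w i j * I i j

lemma couplingSum_mono (K : Couplings m) {I J : Fin m → Fin m → ℝ} (h : ∀ i j, I i j ≤ J i j) :
    couplingSum K I ≤ couplingSum K J := by
  unfold couplingSum
  gcongr with j _ j _ i _
  · exact K.β_nonneg j
  · exact h j j
  · exact K.w_nonneg i j
  · exact h i j

lemma couplingSum_one_nonneg (K : Couplings m) : 0 ≤ couplingSum K fun _ _ => 1 :=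
  (le_of_eq (by simp [couplingSum])).trans (couplingSum_mono K (I := fun _ _ => 0)
    fun _ _ => zero_le_one)

lemma couplingSum_add_smul (K : Couplings m) (I J : Fin m → Fin m → ℝ) (a : ℝ) :
    couplingSum K (fun i j => I i j + a * J i j) = couplingSum K I + a * couplingSum K J := by
  have hβ : ∀ j, K.β j * (I j j + a * J j j) = K.β j * I j j + a * (K.β j * J j j) :=
    fun j => by ring
  have hw : ∀ i j, K.w i j * (I i j + a * J i j) = K.w i j * I i j + a * (K.w i j * J i j) :=
    fun i j => by ring
  simp only [couplingSum, hβ, hw, Finset.sum_add_distrib, ← Finset.mul_sum]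
  ring

lemma nonlocalEnergy_eq_couplingSum (K : Couplings m) (Φ : Space N → ℝ) (ε : ℝ)
    (u : Fin m → Space N → ℂ) : nonlocalEnergy K Φ ε u = couplingSum K fun i j =>
      interaction Φ ε (fun x => ‖u i x‖ ^ 2) (fun x => ‖u j x‖ ^ 2) :=
  rfl

lemma nonlocalEnergy_le (K : Couplings m) {Φ : Space N → ℝ} {B : ℝ} (hΦ : DerivBound 3 Φ B)
    (hmax : 1 < m → ∀ z, Φ z ≤ Φ 0) {u : Fin m → Space N → ℂ}
    (hu : ∀ j, MemLp (u j) 2 volume) (ε : ℝ) (X : Space N) :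
    nonlocalEnergy K Φ ε u ≤ couplingSum K (fun i j => Φ 0 * mass u i * mass u j)
      + 2 * totalMass u * (ckConst 3 N * B) * densityDefectNorm ε (totalMass u) u X
        * couplingSum K (fun _ _ => 1) := by
  rw [nonlocalEnergy_eq_couplingSum, ← couplingSum_add_smul]
  refine couplingSum_mono K fun i j => ?_
  rw [mul_one]
  exact interaction_normSq_le hΦ hmax hu ε X i j

/-! ### The energy in terms of `Ω` -/

lemma kineticDefect_le {A : Space N → Space N} {B : ℝ} (hA : DerivBound 3 A B)
    {u : Fin m → Space N → ℂ} (hu : ∀ j, MemH1 (u j)) (ε M : ℝ) (X Ξ : Space N) :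
    kineticDefect A ε u (Ξ + A (ε • X)) ≤ -(1 / 2) * M * ‖Ξ‖ ^ 2
      + ((1 / 2) * (ckConst 3 N * (2 ^ 3 * (‖Ξ + A (ε • X)‖ + B) ^ 2)) + ‖Ξ + A (ε • X)‖ + 1)
        * reducedOmega A ε M u X Ξ := by
  set b := Ξ + A (ε • X) with hb
  set Ω := reducedOmega A ε M u X Ξ
  have hu2 := fun j => (hu j).1
  have hq := integrable_momentum hu hA ε
  have hbX : b - A (ε • X) = Ξ := by rw [hb, add_sub_cancel_right]
  have hsq := (abs_le.1 ((hA.const_sub b).normSq.abs_densityDefect_le (ε := ε) (M := M) (X := X)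
    hu2)).2.trans (mul_le_mul_of_nonneg_left (densityDefectNorm_le_reducedOmega (A := A) (Ξ := Ξ))
      (mul_nonneg (ckConst_pos 3 N).le (hA.const_sub b).normSq.nonneg))
  rw [densityDefect, hbX] at hsq
  have hsplit : ∫ x, inner ℝ (b - A (ε • x)) (momentum A ε u x)
      = inner ℝ b (∫ x, momentum A ε u x) - ∫ x, inner ℝ (A (ε • x)) (momentum A ε u x) := by
    simp only [inner_sub_left]
    rw [integral_sub (hq.const_inner b) (hA.integrable_inner_comp_smul hq ε), integral_inner hq]
  have hmomentum := (abs_le.1 ((abs_real_inner_le_norm b ((∫ x, momentum A ε u x) - M • Ξ)).trans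
    (mul_le_mul_of_nonneg_left (norm_integral_momentum_sub_le_reducedOmega (X := X))
      (norm_nonneg b)))).1
  have hinner : inner ℝ b (M • Ξ) = M * (‖Ξ‖ ^ 2 + inner ℝ (A (ε • X)) Ξ) := by
    rw [real_inner_smul_right, hb, inner_add_left, real_inner_self_eq_norm_sq]
  rw [inner_sub_right, hinner] at hmomentum
  have hrhoA := (abs_le.1 (rhoA_le_reducedOmega (A := A) (ε := ε) (M := M) (u := u) (X := X)
    (Ξ := Ξ))).2
  rw [kineticDefect, hsplit]
  linarith

lemma exists_energy_recentred_le (K : Couplings m) {P : Potentials N} {BA BV BΦ : ℝ}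
    (hA : DerivBound 3 P.A BA) (hV : DerivBound 3 P.V BV) (hΦ : DerivBound 3 P.Φ BΦ)
    (hmax : 1 < m → ∀ z, P.Φ z ≤ P.Φ 0) (R M : ℝ) :
    ∃ C, ∀ (ε : ℝ) (u : Fin m → Space N → ℂ) (X Ξ : Space N), (∀ j, MemH1 (u j)) →
      totalMass u = M → ‖Ξ + P.A (ε • X)‖ ≤ R →
      energy K (recentred P.A ε u X Ξ) ≤ totalEnergy K P ε u
        - M * ((1 / 2) * ‖Ξ‖ ^ 2 + P.V (ε • X))
        + couplingSum K (fun i j => P.Φ 0 * mass u i * mass u j)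
        + C * reducedOmega P.A ε M u X Ξ := by
  refine ⟨ckConst 3 N * BV + 2 * M * (ckConst 3 N * BΦ) * couplingSum K (fun _ _ => 1)
    + ((1 / 2) * (ckConst 3 N * (2 ^ 3 * (R + BA) ^ 2)) + R + 1), fun ε u X Ξ hu hM hR => ?_⟩
  subst hM
  set M := totalMass u
  set Ω := reducedOmega P.A ε M u X Ξ
  have hu2 := fun j => (hu j).1
  have hΩ : 0 ≤ Ω := reducedOmega_nonneg
  have hδ : densityDefectNorm ε M u X ≤ Ω := densityDefectNorm_le_reducedOmega
  have hck := (ckConst_pos 3 N).le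
  have hM := totalMass_nonneg u
  have hBA := hA.nonneg
  have hBV := hV.nonneg
  have hBΦ := hΦ.nonneg
  have hS := couplingSum_one_nonneg K
  have hpotential := (abs_le.1 (hV.abs_densityDefect_le (ε := ε) (M := M) (X := X) hu2)).1
  rw [densityDefect] at hpotential
  have hpotential' : ckConst 3 N * BV * densityDefectNorm ε M u X ≤ ckConst 3 N * BV * Ω := by
    gcongr
  have hnonlocal : nonlocalEnergy K P.Φ ε u ≤ couplingSum K (fun i j => P.Φ 0 * mass u i * mass u j)
      + 2 * M * (ckConst 3 N * BΦ) * Ω * couplingSum K (fun _ _ => 1) :=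
    (nonlocalEnergy_le K hΦ hmax hu2 ε X).trans (by gcongr)
  have hkinetic : kineticDefect P.A ε u (Ξ + P.A (ε • X)) ≤ -(1 / 2) * M * ‖Ξ‖ ^ 2
      + ((1 / 2) * (ckConst 3 N * (2 ^ 3 * (R + BA) ^ 2)) + R + 1) * Ω :=
    (kineticDefect_le hA hu ε M X Ξ).trans (by gcongr)
  rw [energy_recentred K hA hV hu]
  linarith

/-! ### The classical Hamiltonian -/

lemma inner_crossB (A : Space N → Space N) (v z : Space N) : inner ℝ v (crossB A v z) = 0 := by
  have hexpand : inner ℝ v (crossB A v z) = ∑ l, ∑ i, v l * v i *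
      (fderiv ℝ A z (stdVec i) l - fderiv ℝ A z (stdVec l) i) := by
    simp only [PiLp.inner_apply, crossB, RCLike.inner_apply, conj_trivial, Finset.sum_mul]
    exact Finset.sum_congr rfl fun l _ => Finset.sum_congr rfl fun i _ => by ring
  have hantisymm : inner ℝ v (crossB A v z) = -inner ℝ v (crossB A v z) := by
    conv_lhs => rw [hexpand, Finset.sum_comm]
    simp only [hexpand, ← Finset.sum_neg_distrib]
    exact Finset.sum_congr rfl fun l _ => Finset.sum_congr rfl fun i _ => by ring
  linarith

lemma IsTrajectory.hamiltonian_eq {P : Potentials N} {ε : ℝ} (hV : Differentiable ℝ P.V)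
    {x₀ ξ₀ : Space N} {x ξ : ℝ → Space N} (h : IsTrajectory P ε x₀ ξ₀ x ξ) {t : ℝ} (ht : 0 ≤ t) :
    (1 / 2) * ‖ξ t‖ ^ 2 + P.V (ε • x t) = (1 / 2) * ‖ξ 0‖ ^ 2 + P.V (ε • x 0) := by
  have hderiv : ∀ s, 0 ≤ s → HasDerivWithinAt (fun t => (1 / 2) * ‖ξ t‖ ^ 2 + P.V (ε • x t)) 0
      (Ici 0) s := fun s hs => by
    have hkinetic := ((h.ξ_deriv s hs).norm_sq).const_mul (1 / 2 : ℝ)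
    have hpotential :=
      (hV (ε • x s)).hasFDerivAt.comp_hasDerivWithinAt s ((h.x_deriv s hs).const_smul ε)
    refine (hkinetic.add hpotential).congr_deriv ?_
    rw [inner_sub_right, inner_neg_right, real_inner_smul_right, real_inner_smul_right,
      inner_crossB, real_inner_comm, inner_gradient_left, map_smul, smul_eq_mul]
    ring
  exact constant_of_has_deriv_right_zero (a := 0) (b := t)
    (fun s hs => (hderiv s hs.1).continuousWithinAt.mono Icc_subset_Ici_self)
    (fun s hs => (hderiv s hs.1).mono (Ici_subset_Ici.2 hs.1)) t ⟨ht, le_rfl⟩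

/-! ### The initial datum -/

lemma interaction_congr {Φ : Space N → ℝ} {ε : ℝ} {a a' b b' : Space N → ℝ}
    (ha : a =ᵐ[volume] a') (hb : b =ᵐ[volume] b') :
    interaction Φ ε a b = interaction Φ ε a' b' := by
  have hsmeared : smeared Φ ε b = smeared Φ ε b' := funext fun z =>
    integral_congr_ae (hb.mono fun y hy => congrArg (Φ (z - ε • y) * ·) hy)
  simp only [interaction_eq_integral_smeared, hsmeared]
  exact integral_congr_ae (ha.mono fun x hx => congrArg (smeared Φ ε b' (ε • x) * ·) hx)

lemma interaction_comp_add (Φ : Space N → ℝ) (ε : ℝ) (a b : Space N → ℝ) (X : Space N) :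
    interaction Φ ε (fun x => a (x + X)) (fun x => b (x + X)) = interaction Φ ε a b := by
  simp only [interaction]
  rw [← integral_add_right_eq_self (fun x => ∫ y, Φ (ε • (x - y)) * a x * b y) X]
  congr 1 with x
  rw [← integral_add_right_eq_self (fun y => Φ (ε • (x + X - y)) * a (x + X) * b y) X]
  simp only [add_sub_add_right_eq_sub]

lemma nonlocalEnergy_congr (K : Couplings m) {Φ : Space N → ℝ} {ε : ℝ} {u v : Fin m → Space N → ℂ}
    (h : ∀ j, u j =ᵐ[volume] v j) : nonlocalEnergy K Φ ε u = nonlocalEnergy K Φ ε v := by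
  have hsq : ∀ j, (fun x => ‖u j x‖ ^ 2) =ᵐ[volume] fun x => ‖v j x‖ ^ 2 := fun j =>
    (h j).mono fun x hx => congrArg (‖·‖ ^ 2) hx
  simp only [nonlocalEnergy, interaction_congr (hsq _) (hsq _)]

lemma density_congr {u v : Fin m → Space N → ℂ} (h : ∀ j, u j =ᵐ[volume] v j) :
    density u =ᵐ[volume] density v := by
  filter_upwards [ae_all_iff.2 h] with x hx
  simp only [density, hx]

section Recentred

variable (A : Space N → Space N) (ε : ℝ) (u : Fin m → Space N → ℂ) (X Ξ : Space N)

lemma nonlocalEnergy_recentred (K : Couplings m) (Φ : Space N → ℝ) :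
    nonlocalEnergy K Φ ε (recentred A ε u X Ξ) = nonlocalEnergy K Φ ε u := by
  have hcomp := fun i j =>
    interaction_comp_add Φ ε (fun x => ‖u i x‖ ^ 2) (fun x => ‖u j x‖ ^ 2) X
  simp only [nonlocalEnergy, norm_recentred, hcomp]

lemma density_recentred (x : Space N) : density (recentred A ε u X Ξ) x = density u (x + X) := by
  simp only [density, norm_recentred]

lemma integral_comp_smul_mul_density_recentred (f : Space N → ℝ) :
    ∫ x, f (ε • X + ε • x) * density (recentred A ε u X Ξ) x = ∫ x, f (ε • x) * density u x := by
  rw [← integral_add_right_eq_self (fun x => f (ε • x) * density u x) X]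
  simp only [density_recentred, smul_add, add_comm (ε • X)]

end Recentred

lemma current_congr {A : Space N → Space N} {ε : ℝ} {u v : Space N → ℂ}
    (hu : ∃ g, HasWeakGrad u g) (h : u =ᵐ[volume] v) :
    current A ε u =ᵐ[volume] current A ε v := by
  filter_upwards [h, weakGrad_congr hu h] with x hx hgrad
  simp only [current, hx, hgrad]

lemma current_planeWave_mul_ofReal_ae_eq {s : Space N → ℝ}
    {g : Space N → EuclideanSpace ℂ (Fin N)} (hs : HasWeakGrad (fun x => (s x : ℂ)) g)
    (A : Space N → Space N) (ε : ℝ) (b : Space N) (κ : ℝ) :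
    current A ε (fun x => planeWave b κ x * (s x : ℂ)) =ᵐ[volume]
      fun x => s x ^ 2 • (b - A (ε • x)) := by
  filter_upwards [(hs.planeWave_mul b κ).weakGrad_ae_eq, hs.im_eq_zero] with x hgrad hreal
  have hphase : conj (planeWave b κ x) * planeWave b κ x = 1 := by
    rw [mul_comm, Complex.mul_conj, Complex.normSq_eq_norm_sq, norm_planeWave]
    simp
  ext k
  have hcancel : conj (planeWave b κ x * (s x : ℂ)) *
        ((planeWave b κ x • (g x + (s x : ℂ) • imVec b)) k
          - Complex.I * ((A (ε • x) k : ℝ) : ℂ) * (planeWave b κ x * (s x : ℂ)))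
      = ((s x : ℝ) : ℂ) * g x k + Complex.I * ((s x ^ 2 * (b k - A (ε • x) k) : ℝ) : ℂ) := by
    simp only [map_mul, Complex.conj_ofReal, PiLp.smul_apply, PiLp.add_apply, imVec_apply,
      smul_eq_mul]
    push_cast
    linear_combination ((s x : ℂ) * g x k
      + Complex.I * (s x : ℂ) ^ 2 * ((b k : ℂ) - (A (ε • x) k : ℂ))) * hphase
  simp only [current, hgrad]
  rw [hcancel]
  simp only [Complex.add_im, Complex.im_ofReal_mul, hreal k, Complex.I_mul_im, Complex.ofReal_re,
    PiLp.smul_apply, PiLp.sub_apply, smul_eq_mul, mul_zero, zero_add]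

lemma initialDatum_eq (A : Space N → Space N) (ε : ℝ) (r : Fin m → Space N → ℝ) (X Ξ : Space N)
    (j : Fin m) : initialDatum A ε r X Ξ j = fun x =>
      planeWave (Ξ + A (ε • X)) (-inner ℝ (A (ε • X)) X) x * ((r j (x + -X) : ℝ) : ℂ) := by
  funext x
  rw [initialDatum, planeWave, mul_comm, ← sub_eq_add_neg]
  congr 4
  rw [inner_sub_right, inner_add_left, real_inner_comm x Ξ]
  ring

lemma recentred_initialDatum (A : Space N → Space N) (ε : ℝ) (r : Fin m → Space N → ℝ)
    (X Ξ : Space N) : recentred A ε (initialDatum A ε r X Ξ) X Ξ = cplx r := by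
  funext j x
  have hphase : inner ℝ (-(Ξ + A (ε • X))) x + -inner ℝ Ξ X
      + (inner ℝ (Ξ + A (ε • X)) (x + X) + -inner ℝ (A (ε • X)) X) = 0 := by
    simp only [inner_neg_left, inner_add_left, inner_add_right]
    ring
  simp only [recentred_eq, initialDatum_eq, add_neg_cancel_right]
  rw [← mul_assoc, planeWave, planeWave, ← Complex.exp_add, ← mul_add, ← Complex.ofReal_add,
    hphase]
  simp [cplx]

section InitialDatum

variable {A : Space N → Space N} {ε : ℝ} {r : Fin m → Space N → ℝ} {u : Fin m → Space N → ℂ}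
  {X Ξ : Space N}

lemma recentred_ae_eq_of_initialDatum (h : ∀ j, u j =ᵐ[volume] initialDatum A ε r X Ξ j)
    (j : Fin m) : recentred A ε u X Ξ j =ᵐ[volume] cplx r j := by
  have hshift := (measurePreserving_add_right volume X).quasiMeasurePreserving.ae_eq_comp (h j)
  filter_upwards [hshift] with x hx
  rw [Function.comp_apply, Function.comp_apply] at hx
  rw [← recentred_initialDatum A ε r X Ξ, recentred, recentred, hx]

lemma current_ae_eq_of_initialDatum {j : Fin m} (hu : ∃ g, HasWeakGrad (u j) g)
    (hr : MemH1 (cplx r j)) (h : u j =ᵐ[volume] initialDatum A ε r X Ξ j) :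
    current A ε (u j) =ᵐ[volume] fun x => ‖u j x‖ ^ 2 • (Ξ + A (ε • X) - A (ε • x)) := by
  have hdatum : u j =ᵐ[volume] fun x => planeWave (Ξ + A (ε • X)) (-inner ℝ (A (ε • X)) X) x *
      ((r j (x + -X) : ℝ) : ℂ) := initialDatum_eq A ε r X Ξ j ▸ h
  filter_upwards [hdatum, current_congr hu hdatum,
    current_planeWave_mul_ofReal_ae_eq (hr.hasWeakGrad.comp_add (-X)) A ε (Ξ + A (ε • X))
      (-inner ℝ (A (ε • X)) X)] with x hx hcongr hcurrent
  rw [hcongr, hcurrent, hx, norm_mul, norm_planeWave, one_mul, Complex.norm_real,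
    Real.norm_eq_abs, sq_abs]

lemma kineticDefect_eq_of_initialDatum (hu : ∀ j, MemH1 (u j)) (hr : ∀ j, MemH1 (cplx r j))
    (h : ∀ j, u j =ᵐ[volume] initialDatum A ε r X Ξ j) :
    kineticDefect A ε u (Ξ + A (ε • X))
      = -(1 / 2) * ∫ x, ‖Ξ + A (ε • X) - A (ε • x)‖ ^ 2 * density u x := by
  have hmomentum : ∫ x, inner ℝ (Ξ + A (ε • X) - A (ε • x)) (momentum A ε u x)
      = ∫ x, ‖Ξ + A (ε • X) - A (ε • x)‖ ^ 2 * density u x := by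
    refine integral_congr_ae ?_
    filter_upwards [ae_all_iff.2 fun j =>
      current_ae_eq_of_initialDatum ⟨_, (hu j).hasWeakGrad⟩ (hr j) (h j)] with x hx
    simp only [momentum_eq_sum, hx, ← Finset.sum_smul]
    rw [real_inner_smul_right, real_inner_self_eq_norm_sq, mul_comm, density]
  rw [kineticDefect, hmomentum]
  ring

lemma abs_densityDefect_le_of_initialDatum {f : Space N → ℝ} {B : ℝ} {k : ℕ}
    (hw : EvenWeight volume (density (cplx r))) (hf : DerivBound k f B) (hk : 2 ≤ k)
    (hr : ∀ j, MemLp (cplx r j) 2 volume) (h : ∀ j, u j =ᵐ[volume] initialDatum A ε r X Ξ j) :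
    |densityDefect ε (totalMass (cplx r)) u X f|
      ≤ B * ε ^ 2 * ∫ x, ‖x‖ ^ 2 * density (cplx r) x := by
  have havg : ∫ x, f (ε • x) * density u x = ∫ x, f (ε • X + ε • x) * density (cplx r) x := by
    rw [← integral_comp_smul_mul_density_recentred A ε u X Ξ f]
    exact integral_congr_ae ((density_congr (recentred_ae_eq_of_initialDatum h)).mono
      fun x hx => congrArg (f (ε • X + ε • x) * ·) hx)
  rw [densityDefect, havg, ← integral_density hr, mul_comm (∫ x, density (cplx r) x)]
  exact hw.abs_integral_sub_le hf hk (ε • X) ε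

end InitialDatum

lemma le_nonlocalEnergy (K : Couplings m) {Φ : Space N → ℝ} {B : ℝ} {k : ℕ}
    (hΦ : DerivBound k Φ B) (hk : 2 ≤ k) {u : Fin m → Space N → ℂ}
    (hw : ∀ j, EvenWeight volume fun x => ‖u j x‖ ^ 2) (ε : ℝ) :
    couplingSum K (fun i j => Φ 0 * mass u i * mass u j) - B * ε ^ 2 * couplingSum K (fun i j =>
        (∫ x, ‖x‖ ^ 2 * ‖u i x‖ ^ 2) * mass u j + mass u i * ∫ x, ‖x‖ ^ 2 * ‖u j x‖ ^ 2)
      ≤ nonlocalEnergy K Φ ε u := by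
  rw [nonlocalEnergy_eq_couplingSum, sub_eq_add_neg, ← neg_mul, ← couplingSum_add_smul]
  refine couplingSum_mono K fun i j => (le_of_eq ?_).trans (le_interaction hΦ hk (hw i) (hw j) ε)
  rw [mass, mass]
  ring

lemma exists_le_energy_initialDatum (K : Couplings m) {P : Potentials N} {BA BV BΦ : ℝ} {k : ℕ}
    (hk : 2 ≤ k) (hA : DerivBound k P.A BA) (hV : DerivBound k P.V BV)
    (hΦ : DerivBound k P.Φ BΦ) {r : Fin m → Space N → ℝ} (hr : ∀ j, MemH1 (cplx r j))
    (hw : ∀ j, EvenWeight volume fun x => ‖cplx r j x‖ ^ 2) (R : ℝ) :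
    ∃ C, ∀ (ε : ℝ) (u : Fin m → Space N → ℂ) (X Ξ : Space N), (∀ j, MemH1 (u j)) →
      (∀ j, u j =ᵐ[volume] initialDatum P.A ε r X Ξ j) → ‖Ξ + P.A (ε • X)‖ ≤ R →
      totalEnergy K P ε u - totalMass (cplx r) * ((1 / 2) * ‖Ξ‖ ^ 2 + P.V (ε • X))
        + couplingSum K (fun i j => P.Φ 0 * mass (cplx r) i * mass (cplx r) j) - C * ε ^ 2
        ≤ energy K (cplx r) := by
  have hdens : EvenWeight volume (density (cplx r)) := EvenWeight.sum hw
  set J := ∫ x, ‖x‖ ^ 2 * density (cplx r) x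
  have hJ : 0 ≤ J := hdens.moment_nonneg
  set Q := couplingSum K fun i j => (∫ x, ‖x‖ ^ 2 * ‖cplx r i x‖ ^ 2) * mass (cplx r) j
    + mass (cplx r) i * ∫ x, ‖x‖ ^ 2 * ‖cplx r j x‖ ^ 2
  refine ⟨BV * J + BΦ * Q + (1 / 2) * (2 ^ k * (R + BA) ^ 2 * J), fun ε u X Ξ hu hu0 hR => ?_⟩
  have hBA := hA.nonneg
  have henergy := energy_congr K (fun j => memH1_recentred (hu j))
    (recentred_ae_eq_of_initialDatum hu0)
  have hnonlocal := le_nonlocalEnergy K hΦ hk hw ε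
  rw [← nonlocalEnergy_congr K (recentred_ae_eq_of_initialDatum hu0), nonlocalEnergy_recentred]
    at hnonlocal
  have hpotential := (abs_le.1 (abs_densityDefect_le_of_initialDatum hdens hV hk
    (fun j => (hr j).1) hu0)).2
  have hkinetic := (abs_le.1 (abs_densityDefect_le_of_initialDatum hdens
    (hA.const_sub (Ξ + P.A (ε • X))).normSq hk (fun j => (hr j).1) hu0)).2
  have hR2 : 2 ^ k * (‖Ξ + P.A (ε • X)‖ + BA) ^ 2 * ε ^ 2 * J
      ≤ 2 ^ k * (R + BA) ^ 2 * ε ^ 2 * J := by gcongr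
  rw [densityDefect] at hpotential hkinetic
  rw [add_sub_cancel_right] at hkinetic
  rw [← henergy, energy_recentred K hA hV hu, kineticDefect_eq_of_initialDatum hu hr hu0]
  linarith

/-! ### The orbit of the ground state -/

/-- The point `(e^{iθ_1} r_1(· + y), …, e^{iθ_m} r_m(· + y))` of the orbit of `r` under
translations and phase rotations. -/
def orbitPoint (r : Fin m → Space N → ℝ) (y : Space N) (θ : Fin m → ℝ) : Fin m → Space N → ℂ :=
  fun j x => Complex.exp (Complex.I * (θ j : ℂ)) * (r j (x + y) : ℂ)

/-- The square of the distance of `U` and `W` in `H^1(ℝ^N; ℂ^m)`. -/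
def h1DistSq (U W : Fin m → Space N → ℂ) : ℝ :=
  ∑ j, h1NormSq fun x => U j x - W j x

lemma orbitPoint_zero (r : Fin m → Space N → ℝ) : orbitPoint r 0 0 = cplx r := by
  funext j x
  simp [orbitPoint, cplx]

lemma orbitPoint_eq (r : Fin m → Space N → ℝ) (y : Space N) (θ : Fin m → ℝ) (j : Fin m) :
    orbitPoint r y θ j = fun x => planeWave 0 (θ j) x * cplx r j (x + y) := by
  funext x
  simp [orbitPoint, planeWave, cplx]

lemma density_orbitPoint (r : Fin m → Space N → ℝ) (y : Space N) (θ : Fin m → ℝ) (x : Space N) :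
    density (orbitPoint r y θ) x = density (cplx r) (x + y) := by
  simp only [density, orbitPoint_eq, norm_mul, norm_planeWave, one_mul]

lemma MemH1.orbitPoint {r : Fin m → Space N → ℝ} {j : Fin m} (hr : MemH1 (cplx r j)) (y : Space N)
    (θ : Fin m → ℝ) : MemH1 (orbitPoint r y θ j) := by
  rw [orbitPoint_eq]
  exact (hr.comp_add y).planeWave_mul 0 (θ j)

lemma h1NormSq_orbitPoint_le {r : Fin m → Space N → ℝ} {j : Fin m} (hr : MemH1 (cplx r j))
    (y : Space N) (θ : Fin m → ℝ) : h1NormSq (orbitPoint r y θ j) ≤ 2 * h1NormSq (cplx r j) := by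
  have h := h1NormSq_planeWave_mul_le (hr.comp_add y) 0 (θ j)
  rw [h1NormSq_comp_add hr] at h
  simpa [orbitPoint_eq] using h

lemma h1DistSq_nonneg (U W : Fin m → Space N → ℂ) : 0 ≤ h1DistSq U W :=
  Finset.sum_nonneg fun _ _ => h1NormSq_nonneg _

lemma h1NormSq_sub_le_h1DistSq (U W : Fin m → Space N → ℂ) (j : Fin m) :
    h1NormSq (fun x => U j x - W j x) ≤ h1DistSq U W :=
  Finset.single_le_sum (f := fun j => h1NormSq fun x => U j x - W j x)
    (fun _ _ => h1NormSq_nonneg _) (Finset.mem_univ j)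

lemma h1DistSq_le_add {U V W : Fin m → Space N → ℂ} (hU : ∀ j, MemH1 (U j))
    (hV : ∀ j, MemH1 (V j)) (hW : ∀ j, MemH1 (W j)) :
    h1DistSq U V ≤ 2 * h1DistSq U W + 2 * h1DistSq V W := by
  simp only [h1DistSq, Finset.mul_sum, ← Finset.sum_add_distrib]
  refine Finset.sum_le_sum fun j _ => ?_
  simpa only [sub_sub_sub_cancel_right] using
    h1NormSq_sub_le ((hU j).sub (hW j)) ((hV j).sub (hW j))

lemma h1DistSq_eq_zero_of_ae_eq {U W : Fin m → Space N → ℂ} (hU : ∀ j, MemH1 (U j))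
    (h : ∀ j, U j =ᵐ[volume] W j) : h1DistSq U W = 0 := by
  refine Finset.sum_eq_zero fun j _ => ?_
  have hL2 : ∫ x, ‖U j x - W j x‖ ^ 2 = 0 := integral_eq_zero_of_ae <| by
    filter_upwards [h j] with x hx
    simp [hx]
  rw [((hU j).hasWeakGrad.sub ((hU j).hasWeakGrad.congr (h j))).h1NormSq_eq, hL2]
  simp

lemma orbitDistSq_le (r : Fin m → Space N → ℝ) (U : Fin m → Space N → ℂ) (y : Space N)
    {θ : Fin m → ℝ} (hθ : ∀ j, θ j ∈ Ico 0 (2 * Real.pi)) :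
    orbitDistSq r U ≤ h1DistSq U (orbitPoint r y θ) := by
  refine csInf_le ⟨0, ?_⟩ ⟨y, θ, hθ, rfl⟩
  rintro d ⟨y, θ, -, rfl⟩
  exact Finset.sum_nonneg fun _ _ => h1NormSq_nonneg _

lemma zero_mem_Ico_two_pi : (0 : ℝ) ∈ Ico 0 (2 * Real.pi) :=
  ⟨le_rfl, Real.two_pi_pos⟩

lemma exists_h1DistSq_orbitPoint_lt {r : Fin m → Space N → ℝ} {U : Fin m → Space N → ℂ} {d : ℝ}
    (h : orbitDistSq r U < d) : ∃ (y : Space N) (θ : Fin m → ℝ),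
      (∀ j, θ j ∈ Ico 0 (2 * Real.pi)) ∧ h1DistSq U (orbitPoint r y θ) < d := by
  obtain ⟨_, ⟨y, θ, hθ, rfl⟩, hd⟩ := exists_lt_of_csInf_lt
    (by exact ⟨_, 0, fun _ => 0, fun _ => zero_mem_Ico_two_pi, rfl⟩) h
  exact ⟨y, θ, hθ, hd⟩

lemma orbitDistSq_nonpos_of_ae_eq {r : Fin m → Space N → ℝ} {U : Fin m → Space N → ℂ}
    (hU : ∀ j, MemH1 (U j)) (h : ∀ j, U j =ᵐ[volume] cplx r j) : orbitDistSq r U ≤ 0 := by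
  refine (orbitDistSq_le r U 0 (θ := 0) fun _ => zero_mem_Ico_two_pi).trans (le_of_eq ?_)
  rw [orbitPoint_zero]
  exact h1DistSq_eq_zero_of_ae_eq hU h

lemma h1DistSq_cplx_le {r : Fin m → Space N → ℝ} (hr : ∀ j, MemH1 (cplx r j))
    {U : Fin m → Space N → ℂ} (hU : ∀ j, MemH1 (U j)) {d : ℝ} (h : orbitDistSq r U < d) :
    h1DistSq U (cplx r) ≤ 2 * d + 12 * ∑ j, h1NormSq (cplx r j) := by
  obtain ⟨y, θ, -, hd⟩ := exists_h1DistSq_orbitPoint_lt h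
  have horbit : h1DistSq (cplx r) (orbitPoint r y θ) ≤ 6 * ∑ j, h1NormSq (cplx r j) := by
    rw [h1DistSq, Finset.mul_sum]
    refine Finset.sum_le_sum fun j _ => ?_
    linarith [h1NormSq_sub_le (hr j) ((hr j).orbitPoint y θ), h1NormSq_orbitPoint_le (hr j) y θ]
  linarith [h1DistSq_le_add hU hr fun j => (hr j).orbitPoint y θ]

/-! ### Localization of the nearest orbit point -/

lemma density_le_two_mul_add (U W : Fin m → Space N → ℂ) (x : Space N) :
    density U x ≤ 2 * density (U - W) x + 2 * density W x := by
  simp only [density, Finset.mul_sum, ← Finset.sum_add_distrib]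
  refine Finset.sum_le_sum fun j _ => ?_
  calc ‖U j x‖ ^ 2 = ‖(U - W) j x + W j x‖ ^ 2 := by simp
    _ ≤ (‖(U - W) j x‖ + ‖W j x‖) ^ 2 := by gcongr; exact norm_add_le _ _
    _ ≤ 2 * ‖(U - W) j x‖ ^ 2 + 2 * ‖W j x‖ ^ 2 := by
        linarith [add_sq_le (a := ‖(U - W) j x‖) (b := ‖W j x‖)]

lemma integral_density_sub_le_h1DistSq {U W : Fin m → Space N → ℂ}
    (hU : ∀ j, MemLp (U j) 2 volume) (hW : ∀ j, MemLp (W j) 2 volume) :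
    ∫ x, density (U - W) x ≤ h1DistSq U W := by
  rw [integral_density (u := U - W) fun j => (hU j).sub (hW j)]
  exact Finset.sum_le_sum fun j _ => integral_normSq_le_h1NormSq _

lemma density_orbitPoint_le {r : Fin m → Space N → ℝ} {y x : Space N} {ρ : ℝ} (θ : Fin m → ℝ)
    (hρ : ρ < ‖y‖) (hx : ‖x‖ ≤ ρ) : density (orbitPoint r y θ) x
      ≤ ((‖y‖ - ρ) ^ 2)⁻¹ * (‖x + y‖ ^ 2 * density (cplx r) (x + y)) := by
  have hfar : ‖y‖ - ρ ≤ ‖x + y‖ := by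
    have htri := norm_sub_le (x + y) x
    rw [add_sub_cancel_left] at htri
    linarith
  have hpos : 0 < ‖y‖ - ρ := sub_pos.2 hρ
  rw [density_orbitPoint, le_inv_mul_iff₀ (pow_pos hpos 2)]
  gcongr
  exact density_nonneg _ _

lemma integral_cutoff_mul_density_le {r : Fin m → Space N → ℝ} {U : Fin m → Space N → ℂ}
    {y : Space N} {θ : Fin m → ℝ} {ρ : ℝ} {f : Space N → ℝ} (hU : ∀ j, MemH1 (U j))
    (hr : ∀ j, MemH1 (cplx r j)) (hmoment : Integrable fun x => ‖x‖ ^ 2 * density (cplx r) x)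
    (hρ : ρ < ‖y‖) (hf : ∀ x, 0 ≤ f x) (hf1 : ∀ x, f x ≤ 1) (hfρ : ∀ x, ρ ≤ ‖x‖ → f x = 0) :
    ∫ x, f x * density U x ≤ 2 * h1DistSq U (orbitPoint r y θ)
      + 2 * (((‖y‖ - ρ) ^ 2)⁻¹ * ∫ x, ‖x‖ ^ 2 * density (cplx r) x) := by
  have hsub : Integrable (density (U - orbitPoint r y θ)) :=
    integrable_density fun j => (hU j).1.sub ((hr j).orbitPoint y θ).1
  have hshift : Integrable fun x => ‖x + y‖ ^ 2 * density (cplx r) (x + y) :=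
    hmoment.comp_add_right y
  have hpointwise : ∀ x, f x * density U x ≤ 2 * density (U - orbitPoint r y θ) x
      + 2 * (((‖y‖ - ρ) ^ 2)⁻¹ * (‖x + y‖ ^ 2 * density (cplx r) (x + y))) := fun x => by
    have hdist := density_nonneg (U - orbitPoint r y θ) x
    have hprofile := density_nonneg (cplx r) (x + y)
    rcases le_or_gt ρ ‖x‖ with hx | hx
    · rw [hfρ x hx, zero_mul]
      positivity
    · calc f x * density U x ≤ density U x :=
            mul_le_of_le_one_left (density_nonneg U x) (hf1 x)
        _ ≤ _ := density_le_two_mul_add U (orbitPoint r y θ) x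
        _ ≤ _ := by gcongr; exact density_orbitPoint_le θ hρ hx.le
  calc ∫ x, f x * density U x
      ≤ ∫ x, (2 * density (U - orbitPoint r y θ) x
        + 2 * (((‖y‖ - ρ) ^ 2)⁻¹ * (‖x + y‖ ^ 2 * density (cplx r) (x + y)))) :=
        integral_mono_of_nonneg
          (Eventually.of_forall fun x => mul_nonneg (hf x) (density_nonneg U x))
          ((hsub.const_mul 2).add ((hshift.const_mul _).const_mul 2))
          (Eventually.of_forall hpointwise)
    _ = 2 * (∫ x, density (U - orbitPoint r y θ) x)
        + 2 * (((‖y‖ - ρ) ^ 2)⁻¹ * ∫ x, ‖x‖ ^ 2 * density (cplx r) x) := by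
        rw [integral_add (hsub.const_mul 2) ((hshift.const_mul _).const_mul 2),
          integral_const_mul, integral_const_mul, integral_const_mul,
          integral_add_right_eq_self (fun x => ‖x‖ ^ 2 * density (cplx r) x) y]
    _ ≤ _ := by
        gcongr
        exact integral_density_sub_le_h1DistSq (fun j => (hU j).1)
          fun j => ((hr j).orbitPoint y θ).1

lemma le_integral_mul_density_recentred {ζ : Space N → ℝ} {B : ℝ} (hζ : DerivBound 3 ζ B)
    (hζ0 : ζ 0 = 1) (A : Space N → Space N) (ε M : ℝ) {u : Fin m → Space N → ℂ}
    (hu : ∀ j, MemLp (u j) 2 volume) (X Ξ : Space N) :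
    M - ckConst 3 N * B * densityDefectNorm ε M u X
      ≤ ∫ x, ζ (ε • x) * density (recentred A ε u X Ξ) x := by
  have h := (abs_le.1 ((hζ.comp_sub_const (ε • X)).abs_densityDefect_le (ε := ε) (M := M)
    (X := X) hu)).1
  rw [densityDefect, sub_self, hζ0,
    ← integral_comp_smul_mul_density_recentred A ε u X Ξ fun z => ζ (z - ε • X)] at h
  simp only [add_sub_cancel_left] at h
  linarith

/- A bump of radius `1 / ε` around the origin sees at least the mass `3 M / 4` of `ψ_ε`, but
little of the mass of `r (· + y)` if `y` is far outside its support. -/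
lemma exists_norm_shift_le {r : Fin m → Space N → ℝ} (hr : ∀ j, MemH1 (cplx r j))
    (hmoment : Integrable fun x => ‖x‖ ^ 2 * density (cplx r) x) {M : ℝ} (hM : 0 < M) :
    ∃ δ > 0, ∃ Y ≥ 0, ∀ (A : Space N → Space N) (ε : ℝ) (u : Fin m → Space N → ℂ) (X Ξ y : Space N)
      (θ : Fin m → ℝ), 0 < ε → (∀ j, MemH1 (u j)) → densityDefectNorm ε M u X ≤ δ →
      h1DistSq (recentred A ε u X Ξ) (orbitPoint r y θ) ≤ M / 8 → ‖y‖ ≤ ε⁻¹ + Y := by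
  obtain ⟨ζ, B, hζ, hζ0, hζ_nonneg, hζ_le, hζ_supp⟩ := exists_bump N 3
  have hB : 0 < B := zero_lt_one.trans_le (by simpa [hζ0] using hζ.norm_le 0)
  have hD : 0 < ckConst 3 N * B := mul_pos (ckConst_pos 3 N) hB
  generalize hJ_def : ∫ x, ‖x‖ ^ 2 * density (cplx r) x = J
  have hJ : 0 ≤ J :=
    hJ_def ▸ integral_nonneg fun x => mul_nonneg (by positivity) (density_nonneg _ x)
  have hY : 0 ≤ 4 * J / M := by positivity
  refine ⟨M / (4 * (ckConst 3 N * B)), by positivity, 1 + 4 * J / M, by positivity,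
    fun A ε u X Ξ y θ hε hu hdefect hdist => ?_⟩
  by_contra! hfar
  have hL : 1 < ‖y‖ - ε⁻¹ := by linarith
  have hsupp : ∀ x : Space N, ε⁻¹ ≤ ‖x‖ → ζ (ε • x) = 0 := fun x hx => hζ_supp _ <| by
    rwa [norm_smul, Real.norm_of_nonneg hε.le, ← inv_le_iff_one_le_mul₀' hε]
  have hupper := integral_cutoff_mul_density_le (θ := θ)
    (fun j => memH1_recentred (A := A) (ε := ε) (X := X) (Ξ := Ξ) (hu j)) hr hmoment
    (sub_pos.1 (zero_lt_one.trans hL)) (fun x => hζ_nonneg (ε • x)) (fun x => hζ_le (ε • x)) hsupp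
  have hlower := le_integral_mul_density_recentred hζ hζ0 A ε M (fun j => (hu j).1) X Ξ
  have hsmall : ckConst 3 N * B * densityDefectNorm ε M u X ≤ M / 4 := by
    linarith [(le_div_iff₀ (by positivity)).1 hdefect]
  have htail : ((‖y‖ - ε⁻¹) ^ 2)⁻¹ * J < M / 4 := by
    rw [inv_mul_lt_iff₀ (by positivity)]
    calc J = 4 * J / M * (M / 4) := by field_simp
      _ < (‖y‖ - ε⁻¹) * (M / 4) := by gcongr; linarith
      _ ≤ (‖y‖ - ε⁻¹) ^ 2 * (M / 4) := by gcongr; exact le_self_pow₀ hL.le two_ne_zero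
  rw [hJ_def] at hupper
  linarith

/- If `Ω` is not small, then the orbit point `r` itself is admissible: its distance is bounded. -/
lemma exists_modulation {r : Fin m → Space N → ℝ} (hr : ∀ j, MemH1 (cplx r j))
    (hmoment : Integrable fun x => ‖x‖ ^ 2 * density (cplx r) x) {M : ℝ} (hM : 0 < M) {C : ℝ}
    (hC : 0 ≤ C) (d : ℝ) (A : Space N → Space N) :
    ∃ ε₀ > 0, ∃ C' > 0, ∃ Y, ∀ ε ∈ Ioo 0 ε₀, ∀ (u : Fin m → Space N → ℂ) (X Ξ : Space N),
      ∃ (y : Space N) (θ : Fin m → ℝ), (∀ j, θ j ∈ Ico 0 (2 * Real.pi)) ∧ ‖y‖ ≤ ε⁻¹ + Y ∧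
        ((∀ j, MemH1 (u j)) → orbitDistSq r (recentred A ε u X Ξ) < d →
          orbitDistSq r (recentred A ε u X Ξ) ≤ C * (reducedOmega A ε M u X Ξ + ε ^ 2) →
          h1DistSq (recentred A ε u X Ξ) (orbitPoint r y θ)
            ≤ C' * (reducedOmega A ε M u X Ξ + ε ^ 2)) := by
  obtain ⟨δ, hδ, Y, hY, hshift⟩ := exists_norm_shift_le hr hmoment hM
  set Z := 2 * |d| + 12 * ∑ j, h1NormSq (cplx r j)
  have hZ : 0 ≤ Z := by
    have hsum : 0 ≤ ∑ j, h1NormSq (cplx r j) := Finset.sum_nonneg fun _ _ => h1NormSq_nonneg _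
    positivity
  set η := min δ (M / (16 * (C + 1)))
  have hη : 0 < η := lt_min hδ (by positivity)
  refine ⟨√η, Real.sqrt_pos.2 hη, C + 1 + Z / η, by positivity, Y, fun ε hε u X Ξ => ?_⟩
  set Ω := reducedOmega A ε M u X Ξ
  have hΩ : 0 ≤ Ω := reducedOmega_nonneg
  have hε0 : 0 < ε := hε.1
  have hεη : ε ^ 2 < η := (Real.lt_sqrt hε0.le).1 hε.2
  by_cases h : (∀ j, MemH1 (u j)) ∧ orbitDistSq r (recentred A ε u X Ξ) ≤ C * (Ω + ε ^ 2) ∧ Ω < η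
  · obtain ⟨hu, hcontrol, hsmall⟩ := h
    obtain ⟨y, θ, hθ, hdist⟩ := exists_h1DistSq_orbitPoint_lt
      (hcontrol.trans_lt (lt_add_of_pos_right _ (pow_pos hε0 2)))
    replace hdist : h1DistSq (recentred A ε u X Ξ) (orbitPoint r y θ) ≤ (C + 1) * (Ω + ε ^ 2) := by
      linarith
    have hM8 : (C + 1) * (Ω + ε ^ 2) ≤ M / 8 := by
      calc (C + 1) * (Ω + ε ^ 2) ≤ (C + 1) * (η + η) := by gcongr
        _ ≤ (C + 1) * (M / (16 * (C + 1)) + M / (16 * (C + 1))) := by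
            gcongr <;> exact min_le_right _ _
        _ = M / 8 := by field_simp; norm_num
    exact ⟨y, θ, hθ, hshift A ε u X Ξ y θ hε0 hu
      (densityDefectNorm_le_reducedOmega.trans (hsmall.le.trans (min_le_left _ _)))
      (hdist.trans hM8), fun _ _ _ => hdist.trans (mul_le_mul_of_nonneg_right
        (le_add_of_nonneg_right (by positivity)) (by positivity))⟩
  · refine ⟨0, 0, fun _ => zero_mem_Ico_two_pi, norm_zero.trans_le (by positivity),
      fun hu hclose hcontrol => ?_⟩
    have hlarge : η ≤ Ω := not_lt.1 fun hsmall => h ⟨hu, hcontrol, hsmall⟩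
    rw [orbitPoint_zero]
    calc h1DistSq (recentred A ε u X Ξ) (cplx r)
        ≤ 2 * d + 12 * ∑ j, h1NormSq (cplx r j) :=
          h1DistSq_cplx_le hr (fun j => memH1_recentred (hu j)) hclose
      _ ≤ Z := add_le_add (mul_le_mul_of_nonneg_left (le_abs_self d) zero_le_two) le_rfl
      _ = Z / η * η := by field_simp
      _ ≤ (C + 1 + Z / η) * (Ω + ε ^ 2) := by
          gcongr
          · exact le_add_of_nonneg_left (by positivity)
          · exact le_add_of_le_of_nonneg hlarge (by positivity)

/-! ### Conservative curves and wave packets -/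

lemma evenWeight_normSq_cplx {r : Fin m → Space N → ℝ} {j : Fin m}
    (hr : MemLp (cplx r j) 2 volume) (hradial : ∀ x y, ‖x‖ = ‖y‖ → r j x = r j y)
    (hmoment : ∀ i : Fin N, MemLp (fun x : Space N => x i * r j x) 2 volume) :
    EvenWeight volume fun x => ‖cplx r j x‖ ^ 2 where
  nonneg x := by positivity
  integrable := integrable_normSq hr
  moment := by
    have hsum : ∀ x : Space N, ‖x‖ ^ 2 * ‖cplx r j x‖ ^ 2 = ∑ i, (x i * r j x) ^ 2 := fun x => by
      simp only [EuclideanSpace.norm_sq_eq, Finset.sum_mul, mul_pow, cplx, Complex.norm_real,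
        Real.norm_eq_abs, sq_abs]
    simp only [hsum]
    exact integrable_finsetSum _ fun i _ => (hmoment i).integrable_sq
  even x := by simp only [cplx, hradial (-x) x (norm_neg x)]

lemma totalMass_cplx_pos {r : Fin m → Space N → ℝ} (hr : ∀ j, MemLp (cplx r j) 2 volume)
    (h : ∃ j, ¬ r j =ᵐ[volume] 0) : 0 < totalMass (cplx r) := by
  obtain ⟨j, hj⟩ := h
  have hmass : ∀ j, 0 ≤ mass (cplx r) j := fun j => integral_nonneg fun _ => by positivity
  refine ((hmass j).lt_of_ne' fun hzero => hj ?_).trans_le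
    (Finset.single_le_sum (fun j _ => hmass j) (Finset.mem_univ j))
  filter_upwards [(integral_eq_zero_iff_of_nonneg (fun x => by positivity)
    (integrable_normSq (hr j))).1 hzero] with x hx
  simpa [cplx] using hx

/-- A curve in `H¹` that starts at `φ₀` and conserves the masses and the total energy `E_ε`. These
are the only properties of the solution `φ_ε` that enter the estimate. -/
structure IsConservativeCurve (K : Couplings m) (P : Potentials N) (ε : ℝ)
    (φ₀ : Fin m → Space N → ℂ) (φ : ℝ → Fin m → Space N → ℂ) : Prop where
  memH1 : ∀ t, 0 ≤ t → ∀ j, MemH1 (φ t j)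
  mass_eq : ∀ t, 0 ≤ t → ∀ j, mass (φ t) j = mass (φ 0) j
  totalEnergy_eq : ∀ t, 0 ≤ t → totalEnergy K P ε (φ t) = totalEnergy K P ε (φ 0)
  init : ∀ j, φ 0 j =ᵐ[volume] φ₀ j

/- `φ 0` itself lies in `H_{A,ε}`, so well-posedness applies with the initial datum `φ 0`. -/
lemma WellPosed.isConservativeCurve {K : Couplings m} {P : Potentials N} {B : ℝ} {k : ℕ}
    (h : WellPosed K P) (hA : DerivBound k P.A B) {ε : ℝ} (hε : 0 < ε)
    {φ₀ : Fin m → Space N → ℂ} {φ : ℝ → Fin m → Space N → ℂ} (hφ : IsSolution K P ε φ₀ φ) :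
    IsConservativeCurve K P ε φ₀ φ := by
  obtain ⟨-, hmass, henergy, -⟩ := (h ε hε (φ 0) (hφ.mem 0 le_rfl)).2.2 φ
    { hφ with init := fun _ => EventuallyEq.rfl }
  exact ⟨fun t ht => (hφ.mem t ht).memH1 hA, hmass, henergy, hφ.init⟩

lemma IsConservativeCurve.orbitDistSq_nonpos {K : Couplings m} {P : Potentials N} {ε : ℝ}
    {r : Fin m → Space N → ℝ} {X Ξ : Space N} {φ : ℝ → Fin m → Space N → ℂ}
    (h : IsConservativeCurve K P ε (initialDatum P.A ε r X Ξ) φ) :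
    orbitDistSq r (recentred P.A ε (φ 0) X Ξ) ≤ 0 :=
  orbitDistSq_nonpos_of_ae_eq (fun j => memH1_recentred (h.memH1 0 le_rfl j))
    (recentred_ae_eq_of_initialDatum h.init)

lemma exists_norm_momentum_le {P : Potentials N} {BA BV : ℝ} {k l : ℕ} (hA : DerivBound k P.A BA)
    (hV : DerivBound l P.V BV) (hl : 1 ≤ l) (ξ₀ : Space N) :
    ∃ R, ∀ (ε : ℝ) (x₀ : Space N) (x ξ : ℝ → Space N) (t : ℝ), IsTrajectory P ε x₀ ξ₀ x ξ →
      0 ≤ t → ‖ξ t + P.A (ε • x t)‖ ≤ R := by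
  refine ⟨√(‖ξ₀‖ ^ 2 + 4 * BV) + BA, fun ε x₀ x ξ t h ht => ?_⟩
  refine (norm_add_le _ _).trans (add_le_add (Real.le_sqrt_of_sq_le ?_) (hA.norm_le _))
  have hdiff : Differentiable ℝ P.V :=
    hV.contDiff.differentiable (by exact_mod_cast (Nat.one_le_iff_ne_zero.1 hl))
  have hhamiltonian := h.hamiltonian_eq hdiff ht
  rw [h.ξ_init] at hhamiltonian
  linarith [abs_le.1 (hV.norm_le (ε • x t)), abs_le.1 (hV.norm_le (ε • x 0))]

lemma exists_energy_sub_le (K : Couplings m) {P : Potentials N} {BA BV BΦ : ℝ}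
    (hA : DerivBound 3 P.A BA) (hV : DerivBound 3 P.V BV) (hΦ : DerivBound 3 P.Φ BΦ)
    (hmax : 1 < m → ∀ z, P.Φ z ≤ P.Φ 0) {r : Fin m → Space N → ℝ}
    (hr : ∀ j, MemH1 (cplx r j)) (hw : ∀ j, EvenWeight volume fun x => ‖cplx r j x‖ ^ 2)
    (ξ₀ : Space N) :
    ∃ C ≥ 0, ∀ (ε : ℝ) (x₀ : Space N) (x ξ : ℝ → Space N) (φ : ℝ → Fin m → Space N → ℂ) (t : ℝ),
      IsTrajectory P ε x₀ ξ₀ x ξ →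
      IsConservativeCurve K P ε (initialDatum P.A ε r (x 0) (ξ 0)) φ → 0 ≤ t →
      totalMass (φ t) = totalMass (cplx r) ∧
      energy K (recentred P.A ε (φ t) (x t) (ξ t)) - energy K (cplx r)
        ≤ C * (reducedOmega P.A ε (totalMass (cplx r)) (φ t) (x t) (ξ t) + ε ^ 2) := by
  obtain ⟨R, hR⟩ := exists_norm_momentum_le hA hV (by norm_num) ξ₀
  obtain ⟨C₁, hC₁⟩ := exists_energy_recentred_le K hA hV hΦ hmax R (totalMass (cplx r))
  obtain ⟨C₂, hC₂⟩ := exists_le_energy_initialDatum K (by norm_num) hA hV hΦ hr hw R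
  refine ⟨max 0 (max C₁ C₂), le_max_left _ _, fun ε x₀ x ξ φ t hx hφ ht => ?_⟩
  have hmass : ∀ j, mass (φ t) j = mass (cplx r) j := fun j => by
    rw [hφ.mass_eq t ht, ← mass_recentred P.A ε (φ 0) (x 0) (ξ 0)]
    refine integral_congr_ae ?_
    filter_upwards [recentred_ae_eq_of_initialDatum hφ.init j] with z hz
    rw [hz]
  have hM : totalMass (φ t) = totalMass (cplx r) := Finset.sum_congr rfl fun j _ => hmass j
  refine ⟨hM, ?_⟩
  have hfinal := hC₁ ε (φ t) (x t) (ξ t) (hφ.memH1 t ht) hM (hR ε x₀ x ξ t hx ht)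
  have hinitial := hC₂ ε (φ 0) (x 0) (ξ 0) (hφ.memH1 0 le_rfl) hφ.init (hR ε x₀ x ξ 0 hx le_rfl)
  rw [hφ.totalEnergy_eq t ht,
    hx.hamiltonian_eq (hV.contDiff.differentiable (by norm_num)) ht] at hfinal
  simp only [hmass] at hfinal
  generalize hΩ_def : reducedOmega P.A ε (totalMass (cplx r)) (φ t) (x t) (ξ t) = Ω at hfinal ⊢
  have hΩ : 0 ≤ Ω := hΩ_def ▸ reducedOmega_nonneg
  calc energy K (recentred P.A ε (φ t) (x t) (ξ t)) - energy K (cplx r)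
      ≤ C₁ * Ω + C₂ * ε ^ 2 := by linarith
    _ ≤ max 0 (max C₁ C₂) * Ω + max 0 (max C₁ C₂) * ε ^ 2 := by gcongr <;> simp
    _ = max 0 (max C₁ C₂) * (Ω + ε ^ 2) := by ring

lemma sqrt_mul_add_sq_le {C Ω ε : ℝ} (hC : 0 ≤ C) (hΩ : 0 ≤ Ω) (hε : 0 ≤ ε) :
    √(C * (Ω + ε ^ 2)) ≤ √C * √Ω + √C * ε := by
  rw [Real.sqrt_mul hC, ← mul_add]
  gcongr
  rw [Real.sqrt_le_left (by positivity)]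
  nlinarith [Real.sq_sqrt hΩ, mul_nonneg (Real.sqrt_nonneg Ω) hε]

/-- The approximate solution `e^{i (Ξ · z + θ + A(ε X) · (z - X))} s(z - y)` with profile `s`. -/
def wavePacket (A : Space N → Space N) (ε : ℝ) (s : Space N → ℝ) (X Ξ y : Space N) (θ : ℝ)
    (z : Space N) : ℂ :=
  Complex.exp (Complex.I * ((inner ℝ Ξ z + θ + inner ℝ (A (ε • X)) (z - X) : ℝ) : ℂ))
    * (s (z - y) : ℂ)

section WavePacket

variable (A : Space N → Space N) (ε : ℝ) (X Ξ y : Space N) (θ : Fin m → ℝ)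

lemma sub_wavePacket_eq (u : Fin m → Space N → ℂ) (r : Fin m → Space N → ℝ) (j : Fin m) :
    (fun z => u j z - wavePacket A ε (r j) X Ξ (X - y) (θ j) z)
      = fun z => planeWave (Ξ + A (ε • X)) (-inner ℝ (A (ε • X)) X) z *
        (fun x => recentred A ε u X Ξ j x - orbitPoint r y θ j x) (z + -X) := by
  funext z
  simp only [wavePacket, orbitPoint, recentred_eq, mul_sub, neg_add_cancel_right, ← mul_assoc]
  congr 2
  · rw [planeWave, planeWave, ← Complex.exp_add, ← mul_add, ← Complex.ofReal_add]
    have hphase : inner ℝ (Ξ + A (ε • X)) z + -inner ℝ (A (ε • X)) X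
        + (inner ℝ (-(Ξ + A (ε • X))) (z + -X) + -inner ℝ Ξ X) = 0 := by
      simp only [inner_neg_left, inner_add_left, inner_add_right, inner_neg_right]
      ring
    rw [hphase]
    simp
  · rw [planeWave, ← Complex.exp_add, ← mul_add, ← Complex.ofReal_add]
    congr 3
    simp only [inner_add_left, inner_sub_right]
    ring
  · congr 2
    abel

variable {u : Fin m → Space N → ℂ} {r : Fin m → Space N → ℝ} (hu : ∀ j, MemH1 (u j))
  (hr : ∀ j, MemH1 (cplx r j)) (j : Fin m)
include hu hr

lemma memH1_sub_wavePacket :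
    MemH1 fun z => u j z - wavePacket A ε (r j) X Ξ (X - y) (θ j) z := by
  rw [sub_wavePacket_eq]
  exact (((memH1_recentred (hu j)).sub ((hr j).orbitPoint y θ)).comp_add (-X)).planeWave_mul _ _

lemma h1NormSq_sub_wavePacket_le :
    h1NormSq (fun z => u j z - wavePacket A ε (r j) X Ξ (X - y) (θ j) z)
      ≤ (2 + 2 * ‖Ξ + A (ε • X)‖ ^ 2) * h1DistSq (recentred A ε u X Ξ) (orbitPoint r y θ) := by
  have hsub := (memH1_recentred (A := A) (ε := ε) (X := X) (Ξ := Ξ) (hu j)).sub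
    ((hr j).orbitPoint y θ)
  rw [sub_wavePacket_eq]
  refine (h1NormSq_planeWave_mul_le (hsub.comp_add (-X)) _ _).trans ?_
  rw [h1NormSq_comp_add hsub]
  gcongr
  exact h1NormSq_sub_le_h1DistSq _ _ j

lemma h1Norm_sub_wavePacket_le {R C Ω : ℝ} (hb : ‖Ξ + A (ε • X)‖ ≤ R) (hC : 0 ≤ C) (hΩ : 0 ≤ Ω)
    (hε : 0 ≤ ε) (hdist : h1DistSq (recentred A ε u X Ξ) (orbitPoint r y θ) ≤ C * (Ω + ε ^ 2)) :
    h1Norm (fun z => u j z - wavePacket A ε (r j) X Ξ (X - y) (θ j) z)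
      ≤ √((2 + 2 * R ^ 2) * C) * √Ω + √((2 + 2 * R ^ 2) * C) * ε := by
  refine le_trans (Real.sqrt_le_sqrt ?_) (sqrt_mul_add_sq_le (by positivity) hΩ hε)
  calc h1NormSq (fun z => u j z - wavePacket A ε (r j) X Ξ (X - y) (θ j) z)
      ≤ (2 + 2 * ‖Ξ + A (ε • X)‖ ^ 2) * h1DistSq (recentred A ε u X Ξ) (orbitPoint r y θ) :=
        h1NormSq_sub_wavePacket_le A ε X Ξ y θ hu hr j
    _ ≤ (2 + 2 * R ^ 2) * (C * (Ω + ε ^ 2)) := by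
        gcongr
        exact h1DistSq_nonneg _ _
    _ = (2 + 2 * R ^ 2) * C * (Ω + ε ^ 2) := (mul_assoc _ _ _).symm

end WavePacket

lemma IsTrajectory.locBdd {P : Potentials N} {ε : ℝ} {x₀ ξ₀ : Space N} {x ξ : ℝ → Space N}
    (h : IsTrajectory P ε x₀ ξ₀ x ξ) : LocBdd x := fun T =>
  (isCompact_Icc (a := (0 : ℝ)) (b := T)).exists_bound_of_continuousOn fun t ht =>
    (h.x_deriv t ht.1).continuousWithinAt.mono Icc_subset_Ici_self

lemma LocBdd.sub {F : Type*} [SeminormedAddCommGroup F] {f g : ℝ → F} (hf : LocBdd f)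
    (hg : LocBdd g) : LocBdd fun t => f t - g t := fun T => by
  obtain ⟨B, hB⟩ := hf T
  obtain ⟨B', hB'⟩ := hg T
  exact ⟨B + B', fun t ht => (norm_sub_le _ _).trans (add_le_add (hB t ht) (hB' t ht))⟩

lemma le_of_mem_Ico_exitTime {T σ : ℝ} {Ω Γ : ℝ → ℝ} (hT : 0 ≤ T) (h0 : Γ 0 ≤ σ) {t : ℝ}
    (ht : t ∈ Ico 0 (exitTime T σ Ω Γ)) : Γ t ≤ σ := by
  rcases ht.1.eq_or_lt with rfl | hpos
  · exact h0
  obtain ⟨t', ⟨-, hbound⟩, htt'⟩ := exists_lt_of_lt_csSup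
    (by exact ⟨0, ⟨le_rfl, hT⟩, fun s hs => absurd (hs.1.trans hs.2) (lt_irrefl _)⟩) ht.2
  exact (hbound t ⟨hpos, htt'⟩).2

theorem mainTheorem2_general (K : Couplings m) {P : Potentials N} {BA BV BΦ : ℝ}
    (hA : DerivBound 3 P.A BA) (hV : DerivBound 3 P.V BV) (hΦ : DerivBound 3 P.Φ BΦ)
    (hmax : 1 < m → ∀ z, P.Φ z ≤ P.Φ 0) {r : Fin m → Space N → ℝ}
    (hr : ∀ j, MemH1 (cplx r j)) (hw : ∀ j, EvenWeight volume fun x => ‖cplx r j x‖ ^ 2)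
    (hM : 0 < totalMass (cplx r)) {c c' : ℝ} (hc : 0 ≤ c) (hconvex : EnergyConvexity K r c c')
    {x₀ ξ₀ : Space N} {x ξ : ℝ → ℝ → Space N}
    (hx : ∀ ε, 0 < ε → IsTrajectory P ε x₀ ξ₀ (x ε) (ξ ε))
    {φ : ℝ → ℝ → Fin m → Space N → ℂ} (hφ : ∀ ε, 0 < ε →
      IsConservativeCurve K P ε (initialDatum P.A ε r (x ε 0) (ξ ε 0)) (φ ε)) :
    ∃ ε₀ > 0, ∃ C > 0, ∃ (θ : ℝ → Fin m → ℝ → ℝ) (y : ℝ → ℝ → Space N)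
      (w : ℝ → ℝ → Fin m → Space N → ℂ), ∀ ε ∈ Ioo 0 ε₀,
        (∀ j t, θ ε j t ∈ Ico 0 (2 * Real.pi)) ∧ (∀ j, LocBdd (θ ε j)) ∧ LocBdd (y ε) ∧
        ∀ t, 0 ≤ t → orbitDistSq r (recentred P.A ε (φ ε t) (x ε t) (ξ ε t)) < c' → ∀ j,
          (∀ z, φ ε t j z
            = wavePacket P.A ε (r j) (x ε t) (ξ ε t) (y ε t) (θ ε j t) z + w ε t j z) ∧
          MemH1 (w ε t j) ∧
          h1Norm (w ε t j)
            ≤ C * √(reducedOmega P.A ε (totalMass (cplx r)) (φ ε t) (x ε t) (ξ ε t)) + C * ε := by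
  obtain ⟨R, hR⟩ := exists_norm_momentum_le hA hV (by norm_num) ξ₀
  obtain ⟨C₁, hC₁, henergy⟩ := exists_energy_sub_le K hA hV hΦ hmax hr hw ξ₀
  obtain ⟨ε₀, hε₀, C₂, hC₂, Y, hmodulation⟩ :=
    exists_modulation hr (EvenWeight.sum hw).moment hM (mul_nonneg hc hC₁) c' P.A
  choose! y θ hθ hy hdist using hmodulation
  refine ⟨ε₀, hε₀, √((2 + 2 * R ^ 2) * C₂), by positivity,
    fun ε j t => θ ε (φ ε t) (x ε t) (ξ ε t) j,
    fun ε t => x ε t - y ε (φ ε t) (x ε t) (ξ ε t),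
    fun ε t j z => φ ε t j z - wavePacket P.A ε (r j) (x ε t) (ξ ε t)
      (x ε t - y ε (φ ε t) (x ε t) (ξ ε t)) (θ ε (φ ε t) (x ε t) (ξ ε t) j) z,
    fun ε hε => ⟨fun j t => hθ ε hε _ _ _ j, fun j T => ⟨2 * Real.pi, fun t _ => ?_⟩,
      (hx ε hε.1).locBdd.sub fun T => ⟨ε⁻¹ + Y, fun t _ => hy ε hε _ _ _⟩,
      fun t ht hclose j => ⟨fun z => (add_sub_cancel _ _).symm,
        memH1_sub_wavePacket P.A ε _ _ _ _ ((hφ ε hε.1).memH1 t ht) hr j, ?_⟩⟩⟩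
  · obtain ⟨hnonneg, hlt⟩ := hθ ε hε (φ ε t) (x ε t) (ξ ε t) j
    exact (Real.norm_of_nonneg hnonneg).trans_le hlt.le
  have hu := (hφ ε hε.1).memH1 t ht
  obtain ⟨hmass, hexcess⟩ := henergy ε x₀ (x ε) (ξ ε) (φ ε) t (hx ε hε.1) (hφ ε hε.1) ht
  have hΓ := hconvex _ (fun j => memH1_recentred (hu j))
    ((totalMass_recentred P.A ε (φ ε t) (x ε t) (ξ ε t)).trans hmass) hclose
  have hΓ' := hΓ.trans ((mul_le_mul_of_nonneg_left hexcess hc).trans_eq (mul_assoc _ _ _).symm)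
  exact h1Norm_sub_wavePacket_le P.A ε _ _ _ _ hu hr j (hR ε x₀ (x ε) (ξ ε) t (hx ε hε.1) ht)
    hC₂.le reducedOmega_nonneg hε.1.le (hdist ε hε _ _ _ hu hclose hΓ')

end SolitonDynamics

end

open SolitonDynamics

theorem mainTheorem2 {m N : ℕ} (hm : 1 ≤ m) (hN : 1 ≤ N)
    (K : SolitonDynamics.Couplings m) (hp : 0 < K.p) (hpN : K.p < 2 / (N : ℝ))
    (P : SolitonDynamics.Potentials N) (hP : P.Regular)
    (hΦ : 1 < m → ∀ z, P.Φ z ≤ P.Φ 0)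
    (r : Fin m → SolitonDynamics.Space N → ℝ) (hr : SolitonDynamics.IsGroundState K r)
    (c c' : ℝ) (hadm : SolitonDynamics.Admissible K P r c c')
    (x₀ ξ₀ : SolitonDynamics.Space N)
    (x ξ : ℝ → ℝ → SolitonDynamics.Space N)
    (hx : ∀ ε, 0 < ε → SolitonDynamics.IsTrajectory P ε x₀ ξ₀ (x ε) (ξ ε))
    (φ : ℝ → ℝ → Fin m → SolitonDynamics.Space N → ℂ)
    (hφ : ∀ ε, 0 < ε → SolitonDynamics.IsSolution K P ε
      (SolitonDynamics.initialDatum P.A ε r (x ε 0) (ξ ε 0)) (φ ε))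
    (T₀ σ₀ ρ : ℝ) (hT₀ : 0 < T₀) (hσ₀ : 0 < σ₀) (hσ₀c : σ₀ < c') (hρ : 0 < ρ)
    (χ : SolitonDynamics.Space N → ℝ) (hχ : SolitonDynamics.IsCutoff ρ χ)
    (M : ℝ) (hM : M = SolitonDynamics.totalMass (SolitonDynamics.cplx r))
    (Ω Γ : ℝ → ℝ → ℝ)
    (hΩ : ∀ ε t, Ω ε t =
      SolitonDynamics.omega P.A χ ε M (φ ε t) (x ε t) (ξ ε t))
    (hΓ : ∀ ε t, Γ ε t = SolitonDynamics.orbitDistSq r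
      (SolitonDynamics.recentred P.A ε (φ ε t) (x ε t) (ξ ε t))) :
    ∃ ε₀ > 0, ∃ C > 0,
      ∃ (θ : ℝ → Fin m → ℝ → ℝ) (y : ℝ → ℝ → SolitonDynamics.Space N)
        (ω : ℝ → ℝ → Fin m → SolitonDynamics.Space N → ℂ),
        ∀ ε ∈ Set.Ioo 0 ε₀,
          (∀ j t, 0 ≤ t → θ ε j t ∈ Set.Ico 0 (2 * Real.pi)) ∧
          (∀ j, SolitonDynamics.LocBdd (θ ε j)) ∧
          SolitonDynamics.LocBdd (y ε) ∧
          ∀ t ∈ Set.Ico 0 (SolitonDynamics.exitTime (T₀ / ε) σ₀ (Ω ε) (Γ ε)), ∀ j,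
            (∀ z, φ ε t j z =
              Complex.exp (Complex.I * ((inner ℝ (ξ ε t) z + θ ε j t
                + inner ℝ (P.A (ε • x ε t)) (z - x ε t) : ℝ) : ℂ)) * (r j (z - y ε t) : ℂ)
              + ω ε t j z) ∧
            SolitonDynamics.MemH1 (ω ε t j) ∧
            SolitonDynamics.h1Norm (ω ε t j) ≤ C * Real.sqrt (Ω ε t) + C * ε := by
  subst hM
  have hA := DerivBound.of_ckNorm hP.A_contDiff hP.A_bdd
  have hV := DerivBound.of_ckNorm hP.V_contDiff hP.V_bdd
  have hΦ' := DerivBound.of_ckNorm hP.Φ_contDiff hP.Φ_bdd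
  have hrm := hr.stationary.memH1
  have hcurve := fun ε hε => hadm.wellPosed.isConservativeCurve hA hε (hφ ε hε)
  obtain ⟨ε₀, hε₀, C, hC, θ, y, ω, h⟩ := mainTheorem2_general K hA hV hΦ' hΦ hrm
    (fun j => evenWeight_normSq_cplx (hrm j).1 (hadm.radial j) (hadm.moment j))
    (totalMass_cplx_pos (fun j => (hrm j).1) hr.stationary.ne_zero) hadm.c_pos.le hadm.convexity
    hx hcurve
  refine ⟨ε₀, hε₀, C, hC, θ, y, ω, fun ε hε => ?_⟩
  obtain ⟨hθ, hθ_bdd, hy_bdd, hpacket⟩ := h ε hε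
  have hT : 0 ≤ T₀ / ε := div_nonneg hT₀.le hε.1.le
  have hΓ_zero : Γ ε 0 ≤ σ₀ := hΓ ε 0 ▸ (hcurve ε hε.1).orbitDistSq_nonpos.trans hσ₀.le
  refine ⟨fun j t _ => hθ j t, hθ_bdd, hy_bdd, fun t ht j => ?_⟩
  have hclose := (le_of_mem_Ico_exitTime hT hΓ_zero ht).trans_lt hσ₀c
  obtain ⟨heq, hmem, hnorm⟩ := hpacket t ht.1 (hΓ ε t ▸ hclose) j
  refine ⟨heq, hmem, hnorm.trans ?_⟩
  rw [hΩ]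
  gcongr
  exact reducedOmega_le_omega χ
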